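/- **Theorem (variance of the entries of singular vector perturbations).** Fix $0<\tau<1$, an integer $r\ge 1$, and a probability measure $\nu$ on $\mathbb R$ with mean zero and variance one that satisfies a logarithmic Sobolev inequality. There are constants $C>0$ and $N$, depending only on $\tau$, $r$ and $\nu$, such that the following holds for all $n\ge N$ and all $p$ with $\tau<p/n<\tau^{-1}$ and $r\le\min(p,n)$. *Model.* Let $Z=\mathcal A^{1/2}X\mathcal B^{1/2}\in\mathbb R^{p\times n}$, where $\mathcal A\in\mathbb R^{p\times p}$ and $\mathcal B\in\mathbb R^{n\times n}$ are deterministic symmetric positive semidefinite matrices with all eigenvalues at most $\tau^{-1}$, and $X$ has i.i.d. $\mathcal N(0,1/n)$ entries. Let $G_{\mathbf u}\in\mathbb R^{p\times p}$ and $G_{\mathbf v}\in\mathbb R^{n\times n}$ have i.i.d. entries of law $\nu$, with $X,G_{\mathbf u},G_{\mathbf v}$ independent, and let $U=[\mathbf u_1,\dots,\mathbf u_p]$ and $V=[\mathbf v_1,\dots,\mathbf v_n]$ be the orthogonal factors of (measurable) QR factorizations of $G_{\mathbf u}$ and $G_{\mathbf v}$ (for instance, the Gram–Schmidt vectors of their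 columns). Let $\tau^{-1}>d_1>d_2>\dots>d_r>0$ be deterministic numbers, which may depend on $n$, with $|d_i-d_j|>\tau$ for $i\ne j$. The signal is $S=\sum_{i\le r}d_i\mathbf u_i\mathbf v_i^\top$ and the data matrix is $S+Z$. *First-order perturbations.* Put $U_r=[\mathbf u_1,\dots,\mathbf u_r]$, $U_c=[\mathbf u_{r+1},\dots,\mathbf u_p]$, $V_r=[\mathbf v_1,\dots,\mathbf v_r]$, $V_c=[\mathbf v_{r+1},\dots,\mathbf v_n]$, $\Sigma_r=\operatorname{diag}(d_1,\dots,d_r)$, and let $D_i$ be the $r\times r$ diagonal matrix with $(i,i)$ entry $0$ and $(j,j)$ entry $1/(d_i^2-d_j^2)$ for $j\ne i$. Define $$\Delta\mathbf u_i^r=d_iU_rD_iU_r^\top Z\mathbf v_i+U_rD_i\Sigma_rV_r^\top Z^\top\mathbf u_i,\qquad \Delta\mathbf u_i^c=d_i^{-1}U_cU_c^\top Z\mathbf v_i,\qquad \Delta\mathbf u_i=\Delta\mathbf u_i^r+\Delta\mathbf u_i^c,$$ $$\Delta\mathbf v_i^r=d_iV_rD_iV_r^\top Z^\top\mathbf u_i+V_rD_i\Sigma_rU_r^\top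 Z\mathbf v_i,\qquad \Delta\mathbf v_i^c=d_i^{-1}V_cV_c^\top Z^\top\mathbf u_i,\qquad \Delta\mathbf v_i=\Delta\mathbf v_i^r+\Delta\mathbf v_i^c .$$ *Conclusion.* For every $i\le r$ with $d_i\ge\tau$ (which is automatic for $i<r$), all $1\le a\le p$ and all $1\le b\le n$, the entries below are square integrable (the expectation is over $X$, $G_{\mathbf u}$ and $G_{\mathbf v}$) and $$\mathbb E[(\Delta\mathbf u_i)_a^2]\le \frac Cn,\qquad \mathbb E[(\Delta\mathbf u_i^c)_a^2]\le\frac Cn,\qquad \mathbb E[(\Delta\mathbf v_i)_b^2]\le \frac Cn,\qquad \mathbb E[(\Delta\mathbf v_i^c)_b^2]\le\frac Cn .$$ The noise-subspace components $\Delta\mathbf u_i^c,\Delta\mathbf v_i^c$ dominate, in the sense that $$\mathbb E[(\Delta\mathbf u_i^r)_a^2]\le\frac C{n^2},\qquad \mathbb E[(\Delta\mathbf v_i^r)_b^2]\le\frac C{n^2},$$ $$\bigl|\mathbb E[(\Delta\mathbf u_i)_a^2]-\mathbb E[(\Delta\mathbf u_i^c)_a^2]\bigr|\le\frac C{n^2},\qquad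 \bigl|\mathbb E[(\Delta\mathbf v_i)_b^2]-\mathbb E[(\Delta\mathbf v_i^c)_b^2]\bigr|\le\frac C{n^2}.$$ -/

import Mathlib

open MeasureTheory ProbabilityTheory Matrix

noncomputable section

/-- The logarithmic Sobolev inequality for a probability measure on the line: for some constant `c`,
`Ent_ν(f²) ≤ c ∫ |f'|² dν` for all test functions `f`. -/
def SatisfiesLogSobolev (ν : Measure ℝ) : Prop :=
  ∃ c : ℝ, 0 < c ∧ ∀ f : ℝ → ℝ, ContDiff ℝ 1 f → HasCompactSupport f →
    (∫ x, f x ^ 2 * Real.log (f x ^ 2) ∂ν) - (∫ x, f x ^ 2 ∂ν) * Real.log (∫ x, f x ^ 2 ∂ν)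
      ≤ c * ∫ x, deriv f x ^ 2 ∂ν

/-- A (measurable) way of computing the orthogonal factor of a QR factorization: for every square
matrix `G`, the matrix `Q G` is orthogonal and `R = (Q G)ᵀ G` is upper triangular. For invertible
`G` the columns of `Q G` are, up to signs, the Gram-Schmidt vectors of the columns of `G`. -/
structure IsQRFactor {m : ℕ} (Q : Matrix (Fin m) (Fin m) ℝ → Matrix (Fin m) (Fin m) ℝ) :
    Prop where
  measurable : Measurable fun (G : Fin m → Fin m → ℝ) (j k : Fin m) => Q (Matrix.of G) j k
  orthogonal : ∀ G, Q G ∈ orthogonalGroup (Fin m) ℝ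
  upperTriangular : ∀ G, ((Q G)ᵀ * G).BlockTriangular id

/-- The signal-plus-noise model `∑ i, d i • u i (v i)ᵀ + Z` of size `p × n` and rank `r`, where
`Z = A^{1/2} X B^{1/2}`, with regularity parameter `τ`. The matrices
`A = Qa diag(σa) Qaᵀ` and `B = Qb diag(σb) Qbᵀ` are symmetric positive semidefinite, `X` is
Gaussian, and the singular vectors come from QR factorizations of random matrices whose entries
have law `ν`. -/
structure SpikedModel (τ : ℝ) (ν : Measure ℝ) (r p n : ℕ) {Ω : Type*} [MeasurableSpace Ω]
    (P : Measure Ω) where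
  rank_le_rows : r ≤ p
  rank_le_cols : r ≤ n
  /-- aspect ratio -/
  lt_ratio : τ < (p : ℝ) / n
  ratio_lt : (p : ℝ) / n < τ⁻¹
  /-- eigendecomposition of `A` -/
  Qa : Matrix (Fin p) (Fin p) ℝ
  σa : Fin p → ℝ
  Qa_mem : Qa ∈ orthogonalGroup (Fin p) ℝ
  σa_nonneg : ∀ k, 0 ≤ σa k
  σa_le : ∀ k, σa k ≤ τ⁻¹
  /-- eigendecomposition of `B` -/
  Qb : Matrix (Fin n) (Fin n) ℝ
  σb : Fin n → ℝ
  Qb_mem : Qb ∈ orthogonalGroup (Fin n) ℝ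
  σb_nonneg : ∀ k, 0 ≤ σb k
  σb_le : ∀ k, σb k ≤ τ⁻¹
  /-- singular values of the signal -/
  d : Fin r → ℝ
  d_pos : ∀ i, 0 < d i
  d_anti : StrictAnti d
  d_lt : ∀ i, d i < τ⁻¹
  d_gap : ∀ i j, i ≠ j → τ < |d i - d j|
  /-- the three random matrices -/
  X : Ω → Matrix (Fin p) (Fin n) ℝ
  Gu : Ω → Matrix (Fin p) (Fin p) ℝ
  Gv : Ω → Matrix (Fin n) (Fin n) ℝ
  X_law : ∀ j k, HasLaw (fun ω => X ω j k) (gaussianReal 0 (1 / (n : NNReal))) P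
  Gu_law : ∀ j k, HasLaw (fun ω => Gu ω j k) ν P
  Gv_law : ∀ j k, HasLaw (fun ω => Gv ω j k) ν P
  /-- all entries of `X`, `Gu`, `Gv` together are independent -/
  indep : iIndepFun
    (fun (s : (Fin p × Fin n) ⊕ (Fin p × Fin p) ⊕ (Fin n × Fin n)) (ω : Ω) =>
      Sum.elim (fun jk => X ω jk.1 jk.2)
        (Sum.elim (fun jk => Gu ω jk.1 jk.2) (fun jk => Gv ω jk.1 jk.2)) s) P
  /-- the QR factorizations that produce the singular vectors -/
  qru : Matrix (Fin p) (Fin p) ℝ → Matrix (Fin p) (Fin p) ℝ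
  qrv : Matrix (Fin n) (Fin n) ℝ → Matrix (Fin n) (Fin n) ℝ
  qru_spec : IsQRFactor qru
  qrv_spec : IsQRFactor qrv

namespace SpikedModel

variable {τ : ℝ} {ν : Measure ℝ} {r p n : ℕ} {Ω : Type*} [MeasurableSpace Ω] {P : Measure Ω}

/-- `A^{1/2}`. -/
def sqrtA (M : SpikedModel τ ν r p n P) : Matrix (Fin p) (Fin p) ℝ :=
  M.Qa * diagonal (fun k => Real.sqrt (M.σa k)) * M.Qaᵀ

/-- `B^{1/2}`. -/
def sqrtB (M : SpikedModel τ ν r p n P) : Matrix (Fin n) (Fin n) ℝ :=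
  M.Qb * diagonal (fun k => Real.sqrt (M.σb k)) * M.Qbᵀ

/-- The noise matrix `Z = A^{1/2} X B^{1/2}`. -/
def Z (M : SpikedModel τ ν r p n P) (ω : Ω) : Matrix (Fin p) (Fin n) ℝ :=
  M.sqrtA * M.X ω * M.sqrtB

/-- The orthogonal matrix of left singular vectors (its columns). -/
def U (M : SpikedModel τ ν r p n P) (ω : Ω) : Matrix (Fin p) (Fin p) ℝ := M.qru (M.Gu ω)

/-- The orthogonal matrix of right singular vectors (its columns). -/
def V (M : SpikedModel τ ν r p n P) (ω : Ω) : Matrix (Fin n) (Fin n) ℝ := M.qrv (M.Gv ω)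

/-- `U_r`: the first `r` columns of `U`. -/
def Ur (M : SpikedModel τ ν r p n P) (ω : Ω) : Matrix (Fin p) (Fin r) ℝ :=
  (M.U ω).submatrix id (Fin.castLE M.rank_le_rows)

/-- `V_r`: the first `r` columns of `V`. -/
def Vr (M : SpikedModel τ ν r p n P) (ω : Ω) : Matrix (Fin n) (Fin r) ℝ :=
  (M.V ω).submatrix id (Fin.castLE M.rank_le_cols)

/-- `U_c`: the remaining columns of `U`. -/
def Uc (M : SpikedModel τ ν r p n P) (ω : Ω) : Matrix (Fin p) {g : Fin p // r ≤ (g : ℕ)} ℝ :=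
  (M.U ω).submatrix id Subtype.val

/-- `V_c`: the remaining columns of `V`. -/
def Vc (M : SpikedModel τ ν r p n P) (ω : Ω) : Matrix (Fin n) {g : Fin n // r ≤ (g : ℕ)} ℝ :=
  (M.V ω).submatrix id Subtype.val

/-- The left singular vector `u_i`. -/
def u (M : SpikedModel τ ν r p n P) (i : Fin r) (ω : Ω) : Fin p → ℝ := fun a => M.Ur ω a i

/-- The right singular vector `v_i`. -/
def v (M : SpikedModel τ ν r p n P) (i : Fin r) (ω : Ω) : Fin n → ℝ := fun b => M.Vr ω b i

/-- `Σ_r = diag(d_1, …, d_r)`. -/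
def Sig (M : SpikedModel τ ν r p n P) : Matrix (Fin r) (Fin r) ℝ := diagonal M.d

/-- `D_i`: diagonal, with `i`-th entry zero and `j`-th entry `1 / (d_i² - d_j²)` for `j ≠ i`. -/
def D (M : SpikedModel τ ν r p n P) (i : Fin r) : Matrix (Fin r) (Fin r) ℝ :=
  diagonal (fun j => if j = i then 0 else 1 / (M.d i ^ 2 - M.d j ^ 2))

/-- `Δu_i^r = d_i U_r D_i U_rᵀ Z v_i + U_r D_i Σ_r V_rᵀ Zᵀ u_i`. -/
def duR (M : SpikedModel τ ν r p n P) (i : Fin r) (ω : Ω) : Fin p → ℝ :=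
  M.d i • ((M.Ur ω * M.D i * (M.Ur ω)ᵀ * M.Z ω) *ᵥ M.v i ω)
    + (M.Ur ω * M.D i * M.Sig * (M.Vr ω)ᵀ * (M.Z ω)ᵀ) *ᵥ M.u i ω

/-- `Δu_i^c = d_i⁻¹ U_c U_cᵀ Z v_i`. -/
def duC (M : SpikedModel τ ν r p n P) (i : Fin r) (ω : Ω) : Fin p → ℝ :=
  (M.d i)⁻¹ • ((M.Uc ω * (M.Uc ω)ᵀ * M.Z ω) *ᵥ M.v i ω)

/-- `Δv_i^r = d_i V_r D_i V_rᵀ Zᵀ u_i + V_r D_i Σ_r U_rᵀ Z v_i`. -/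
def dvR (M : SpikedModel τ ν r p n P) (i : Fin r) (ω : Ω) : Fin n → ℝ :=
  M.d i • ((M.Vr ω * M.D i * (M.Vr ω)ᵀ * (M.Z ω)ᵀ) *ᵥ M.u i ω)
    + (M.Vr ω * M.D i * M.Sig * (M.Ur ω)ᵀ * M.Z ω) *ᵥ M.v i ω

/-- `Δv_i^c = d_i⁻¹ V_c V_cᵀ Zᵀ u_i`. -/
def dvC (M : SpikedModel τ ν r p n P) (i : Fin r) (ω : Ω) : Fin n → ℝ :=
  (M.d i)⁻¹ • ((M.Vc ω * (M.Vc ω)ᵀ * (M.Z ω)ᵀ) *ᵥ M.u i ω)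

/-- The first-order perturbation `Δu_i = Δu_i^r + Δu_i^c` of the left singular vector `u_i`. -/
def du (M : SpikedModel τ ν r p n P) (i : Fin r) (ω : Ω) : Fin p → ℝ := M.duR i ω + M.duC i ω

/-- The first-order perturbation `Δv_i = Δv_i^r + Δv_i^c` of the right singular vector `v_i`. -/
def dv (M : SpikedModel τ ν r p n P) (i : Fin r) (ω : Ω) : Fin n → ℝ := M.dvR i ω + M.dvC i ω

end SpikedModel

end

/-!
An entry of `Δu_i` is a linear form in the white noise `X` whose coefficient matrix depends on the
frames `U_r` and `V_r` only, hence is independent of `X`. The second moment of such a form is `1/n`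
times the expected squared norm of its coefficient matrix, and likewise for the product of two
forms. In the direction `x`, the coefficient of the part inside the signal subspace has squared norm
`O(|U_rᵀ x|²)`, that of the part outside it is bounded, and their inner product is
`O(|U_rᵀ x|² + |U_rᵀ 𝒜 x|²)`, since `U_rᵀ` factors out of it on both sides. Everything thus reduces
to the delocalization bound `E |U_rᵀ x|² ≤ C |x|² / n`.

For the latter, let `g = U_r R` consist of the first `r` columns of the random matrix. If the Gram
matrix `gᵀ g` is at least `c n`, then `|U_rᵀ x|² ≤ |gᵀ x|² / (c n)`, whose mean is `O(|x|² / n)`;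
otherwise `|U_rᵀ x|² ≤ |x|²`, and Chebyshev's inequality shows that this happens with probability
`O(1/n)`. Truncating the squared entries on the diagonal of `gᵀ g`, which only decreases it, makes
two moments of the entries suffice.
-/

noncomputable section

section SquaredNorm

variable {ι κ : Type*} [Fintype ι] [Fintype κ]

theorem dotProduct_self_nonneg (x : ι → ℝ) : 0 ≤ x ⬝ᵥ x :=
  dotProduct_self_star_nonneg x

theorem dotProduct_sq_le (x y : ι → ℝ) : (x ⬝ᵥ y) ^ 2 ≤ (x ⬝ᵥ x) * (y ⬝ᵥ y) := by
  simpa only [dotProduct, sq] using Finset.sum_mul_sq_le_sq_mul_sq Finset.univ x y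

theorem add_dotProduct_self_le (x y : ι → ℝ) :
    (x + y) ⬝ᵥ (x + y) ≤ 2 * (x ⬝ᵥ x + y ⬝ᵥ y) := by
  have h := dotProduct_self_nonneg (x - y)
  simp only [add_dotProduct, dotProduct_add, sub_dotProduct, dotProduct_sub,
    dotProduct_comm y x] at h ⊢
  linarith

theorem two_mul_abs_dotProduct_le (x y : ι → ℝ) : 2 * |x ⬝ᵥ y| ≤ x ⬝ᵥ x + y ⬝ᵥ y := by
  have hsub := dotProduct_self_nonneg (x - y)
  have hadd := dotProduct_self_nonneg (x + y)
  simp only [add_dotProduct, dotProduct_add, sub_dotProduct, dotProduct_sub,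
    dotProduct_comm y x] at hsub hadd
  rcases abs_cases (x ⬝ᵥ y) with ⟨h, -⟩ | ⟨h, -⟩ <;> rw [h] <;> linarith

theorem smul_dotProduct_smul_self (t : ℝ) (x : ι → ℝ) :
    (t • x) ⬝ᵥ (t • x) = t ^ 2 * (x ⬝ᵥ x) := by
  rw [smul_dotProduct, dotProduct_smul, smul_eq_mul, smul_eq_mul]
  ring

theorem vec_dotProduct_vec_vecMulVec (A : Matrix ι κ ℝ) (x : ι → ℝ) (y : κ → ℝ) :
    vec A ⬝ᵥ vec (vecMulVec x y) = x ⬝ᵥ A *ᵥ y := by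
  rw [dotProduct_comm, vec_dotProduct_vec, transpose_vecMulVec, vecMulVec_mul, trace_vecMulVec,
    dotProduct_comm, dotProduct_mulVec]

theorem vec_vecMulVec_dotProduct_vec_vecMulVec (x x' : ι → ℝ) (y y' : κ → ℝ) :
    vec (vecMulVec x y) ⬝ᵥ vec (vecMulVec x' y') = (x ⬝ᵥ x') * (y ⬝ᵥ y') := by
  rw [vec_dotProduct_vec_vecMulVec, vecMulVec_mulVec, dotProduct_smul, dotProduct_comm x,
    op_smul_eq_mul]

theorem dotProduct_mulVec_self_sq_le (A : Matrix ι ι ℝ) (y : ι → ℝ) :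
    (y ⬝ᵥ A *ᵥ y) ^ 2 ≤ (vec A ⬝ᵥ vec A) * (y ⬝ᵥ y) ^ 2 := by
  have h := dotProduct_sq_le (vec A) (vec (vecMulVec y y))
  rwa [vec_dotProduct_vec_vecMulVec, vec_vecMulVec_dotProduct_vec_vecMulVec, ← sq] at h

theorem le_transpose_mulVec_dotProduct_self {R : Matrix κ κ ℝ} {c : ℝ} (hc : 0 < c)
    (hlow : ∀ y, c * (y ⬝ᵥ y) ≤ (R *ᵥ y) ⬝ᵥ (R *ᵥ y)) (w : κ → ℝ) :
    c * (w ⬝ᵥ w) ≤ (Rᵀ *ᵥ w) ⬝ᵥ (Rᵀ *ᵥ w) := by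
  classical
  have hinj : Function.Injective R.mulVec := by
    refine (injective_iff_map_eq_zero (mulVecLin R)).mpr fun y (hy : R *ᵥ y = 0) => ?_
    have h := hlow y
    rw [hy, dotProduct_zero] at h
    exact dotProduct_self_eq_zero.mp
      (le_antisymm (nonpos_of_mul_nonpos_right h hc) (dotProduct_self_nonneg y))
  obtain ⟨y, hy⟩ := mulVec_surjective_iff_isUnit.mpr (mulVec_injective_iff_isUnit.mp hinj) w
  have hyw : c * (y ⬝ᵥ y) ≤ w ⬝ᵥ w := by simpa only [hy] using hlow y
  have hcs : (w ⬝ᵥ w) ^ 2 ≤ ((Rᵀ *ᵥ w) ⬝ᵥ (Rᵀ *ᵥ w)) * (y ⬝ᵥ y) := by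
    have h := dotProduct_sq_le (Rᵀ *ᵥ w) y
    rwa [mulVec_transpose, ← dotProduct_mulVec, hy, ← mulVec_transpose] at h
  rcases (dotProduct_self_nonneg w).eq_or_lt with h0 | hpos
  · rw [← h0, mul_zero]
    exact dotProduct_self_nonneg _
  · refine le_of_mul_le_mul_right ?_ hpos
    calc c * (w ⬝ᵥ w) * (w ⬝ᵥ w) = c * (w ⬝ᵥ w) ^ 2 := by ring
      _ ≤ c * (((Rᵀ *ᵥ w) ⬝ᵥ (Rᵀ *ᵥ w)) * (y ⬝ᵥ y)) := by gcongr
      _ = ((Rᵀ *ᵥ w) ⬝ᵥ (Rᵀ *ᵥ w)) * (c * (y ⬝ᵥ y)) := by ring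
      _ ≤ ((Rᵀ *ᵥ w) ⬝ᵥ (Rᵀ *ᵥ w)) * (w ⬝ᵥ w) :=
        mul_le_mul_of_nonneg_left hyw (dotProduct_self_nonneg _)

end SquaredNorm

section OrthonormalColumns

variable {ι κ : Type*} [Fintype ι] [Fintype κ] [DecidableEq κ] {Q : Matrix ι κ ℝ}

theorem mulVec_dotProduct_mulVec (hQ : Qᵀ * Q = 1) (y z : κ → ℝ) :
    (Q *ᵥ y) ⬝ᵥ (Q *ᵥ z) = y ⬝ᵥ z := by
  rw [← dotProduct_transpose_mulVec, mulVec_mulVec, hQ, one_mulVec,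
    dotProduct_comm]

theorem sub_mulVec_transpose_mulVec_dotProduct_self (hQ : Qᵀ * Q = 1) (x : ι → ℝ) :
    (x - Q *ᵥ (Qᵀ *ᵥ x)) ⬝ᵥ (x - Q *ᵥ (Qᵀ *ᵥ x)) = x ⬝ᵥ x - (Qᵀ *ᵥ x) ⬝ᵥ (Qᵀ *ᵥ x) := by
  have hx : x ⬝ᵥ Q *ᵥ (Qᵀ *ᵥ x) = (Qᵀ *ᵥ x) ⬝ᵥ (Qᵀ *ᵥ x) := by
    rw [dotProduct_mulVec, ← mulVec_transpose]
  simp only [sub_dotProduct, dotProduct_sub, mulVec_dotProduct_mulVec hQ, hx,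
    dotProduct_comm (Q *ᵥ (Qᵀ *ᵥ x)) x]
  ring

theorem transpose_mulVec_dotProduct_self_le (hQ : Qᵀ * Q = 1) (x : ι → ℝ) :
    (Qᵀ *ᵥ x) ⬝ᵥ (Qᵀ *ᵥ x) ≤ x ⬝ᵥ x := by
  rw [← sub_nonneg, ← sub_mulVec_transpose_mulVec_dotProduct_self hQ x]
  exact dotProduct_self_nonneg _

theorem transpose_mulVec_dotProduct_self_le_of_eq_mul {G : Matrix ι κ ℝ} {R : Matrix κ κ ℝ}
    (hQ : Qᵀ * Q = 1) (hG : G = Q * R) {c : ℝ} (hc : 0 < c)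
    (hlow : ∀ y, c * (y ⬝ᵥ y) ≤ (G *ᵥ y) ⬝ᵥ (G *ᵥ y)) (x : ι → ℝ) :
    c * ((Qᵀ *ᵥ x) ⬝ᵥ (Qᵀ *ᵥ x)) ≤ (Gᵀ *ᵥ x) ⬝ᵥ (Gᵀ *ᵥ x) := by
  have hR := le_transpose_mulVec_dotProduct_self (R := R) hc fun y => by
    simpa only [hG, ← mulVec_mulVec, mulVec_dotProduct_mulVec hQ] using hlow y
  simpa only [hG, transpose_mul, ← mulVec_mulVec] using hR (Qᵀ *ᵥ x)

end OrthonormalColumns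

section WhiteNoise

variable {Ω ι : Type*} [MeasurableSpace Ω] {P : Measure Ω} {Y : Ω → ι → ℝ} {σ : ℝ}

/-- White noise of level `σ`: a family of square integrable, pairwise orthogonal random variables
with common second moment `σ`. Independence is not part of the notion. -/
structure IsWhiteNoise (Y : Ω → ι → ℝ) (σ : ℝ) (P : Measure Ω) : Prop where
  memLp : ∀ s, MemLp (fun ω => Y ω s) 2 P
  integral_sq : ∀ s, ∫ ω, Y ω s ^ 2 ∂P = σ
  integral_mul_of_ne : ∀ s t, s ≠ t → ∫ ω, Y ω s * Y ω t ∂P = 0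

theorem IsWhiteNoise.of_pairwise_indepFun (hmem : ∀ s, MemLp (fun ω => Y ω s) 2 P)
    (hindep : ∀ s t, s ≠ t → IndepFun (fun ω => Y ω s) (fun ω => Y ω t) P)
    (hmean : ∀ s, ∫ ω, Y ω s ∂P = 0) (hsq : ∀ s, ∫ ω, Y ω s ^ 2 ∂P = σ) :
    IsWhiteNoise Y σ P where
  memLp := hmem
  integral_sq := hsq
  integral_mul_of_ne s t hst := by
    rw [(hindep s t hst).integral_fun_mul_eq_mul_integral (hmem s).1 (hmem t).1, hmean s,
      zero_mul]

theorem memLp_two_mul_of_indepFun {f g : Ω → ℝ} (hf : MemLp f 2 P) (hg : MemLp g 2 P)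
    (h : IndepFun f g P) : MemLp (fun ω => f ω * g ω) 2 P := by
  refine (memLp_two_iff_integrable_sq (hf.1.mul hg.1)).mpr ?_
  have hsq : IndepFun (fun ω => f ω ^ 2) (fun ω => g ω ^ 2) P :=
    h.comp (φ := (· ^ 2)) (ψ := (· ^ 2)) (by fun_prop) (by fun_prop)
  simp only [Pi.mul_apply, mul_pow]
  exact hsq.integrable_mul hf.integrable_sq hg.integrable_sq

variable {c c' : Ω → ι → ℝ}

theorem IsWhiteNoise.integrable_and_integral_mul_mul_mul (hY : IsWhiteNoise Y σ P)
    (hc : ∀ s, MemLp (fun ω => c ω s) 2 P) (hc' : ∀ s, MemLp (fun ω => c' ω s) 2 P)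
    (hind : IndepFun (fun ω => (c ω, c' ω)) Y P) (s t : ι) :
    Integrable (fun ω => (c ω s * Y ω s) * (c' ω t * Y ω t)) P ∧
      ∫ ω, (c ω s * Y ω s) * (c' ω t * Y ω t) ∂P
        = (∫ ω, c ω s * c' ω t ∂P) * ∫ ω, Y ω s * Y ω t ∂P := by
  have h : IndepFun (fun ω => c ω s * c' ω t) (fun ω => Y ω s * Y ω t) P :=
    hind.comp (φ := fun x : (ι → ℝ) × (ι → ℝ) => x.1 s * x.2 t)
      (ψ := fun y : ι → ℝ => y s * y t) (by fun_prop) (by fun_prop)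
  have hcc := (hc s).integrable_mul (hc' t)
  have hYY := (hY.memLp s).integrable_mul (hY.memLp t)
  have hcomm : (fun ω => (c ω s * Y ω s) * (c' ω t * Y ω t))
      = fun ω => (c ω s * c' ω t) * (Y ω s * Y ω t) := funext fun ω => mul_mul_mul_comm _ _ _ _
  rw [hcomm]
  exact ⟨h.integrable_mul hcc hYY, h.integral_fun_mul_eq_mul_integral hcc.1 hYY.1⟩

variable [Fintype ι]

theorem IsWhiteNoise.memLp_dotProduct (hY : IsWhiteNoise Y σ P)
    (hc : ∀ s, MemLp (fun ω => c ω s) 2 P) (hind : IndepFun c Y P) :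
    MemLp (fun ω => c ω ⬝ᵥ Y ω) 2 P :=
  memLp_finsetSum _ fun s _ => memLp_two_mul_of_indepFun (hc s) (hY.memLp s)
    (hind.comp (measurable_pi_apply s) (measurable_pi_apply s))

theorem IsWhiteNoise.integral_dotProduct_mul_dotProduct (hY : IsWhiteNoise Y σ P)
    (hc : ∀ s, MemLp (fun ω => c ω s) 2 P) (hc' : ∀ s, MemLp (fun ω => c' ω s) 2 P)
    (hind : IndepFun (fun ω => (c ω, c' ω)) Y P) :
    ∫ ω, (c ω ⬝ᵥ Y ω) * (c' ω ⬝ᵥ Y ω) ∂P = σ * ∫ ω, c ω ⬝ᵥ c' ω ∂P := by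
  have hterm := hY.integrable_and_integral_mul_mul_mul hc hc' hind
  calc ∫ ω, (c ω ⬝ᵥ Y ω) * (c' ω ⬝ᵥ Y ω) ∂P
      = ∑ s, ∑ t, (∫ ω, c ω s * c' ω t ∂P) * ∫ ω, Y ω s * Y ω t ∂P := by
        simp only [dotProduct, Finset.sum_mul_sum]
        rw [integral_finsetSum _ fun s _ => integrable_finsetSum _ fun t _ => (hterm s t).1]
        refine Finset.sum_congr rfl fun s _ => ?_
        rw [integral_finsetSum _ fun t _ => (hterm s t).1]
        exact Finset.sum_congr rfl fun t _ => (hterm s t).2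
    _ = ∑ s, (∫ ω, c ω s * c' ω s ∂P) * σ := by
        refine Finset.sum_congr rfl fun s _ => ?_
        rw [Finset.sum_eq_single s (fun t _ hts => by
          rw [hY.integral_mul_of_ne s t hts.symm, mul_zero]) (by simp), ← hY.integral_sq s]
        simp only [sq]
    _ = σ * ∫ ω, c ω ⬝ᵥ c' ω ∂P := by
        have hint (s : ι) : Integrable (fun ω => c ω s * c' ω s) P :=
          (hc s).integrable_mul (hc' s)
        simp only [dotProduct]
        rw [integral_finsetSum _ fun s _ => hint s, Finset.mul_sum]
        exact Finset.sum_congr rfl fun s _ => mul_comm _ _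

theorem IsWhiteNoise.integral_dotProduct_sq (hY : IsWhiteNoise Y σ P)
    (hc : ∀ s, MemLp (fun ω => c ω s) 2 P) (hind : IndepFun c Y P) :
    ∫ ω, (c ω ⬝ᵥ Y ω) ^ 2 ∂P = σ * ∫ ω, c ω ⬝ᵥ c ω ∂P := by
  have hpair : IndepFun (fun ω => (c ω, c ω)) Y P :=
    hind.comp (φ := fun x => (x, x)) (by fun_prop) measurable_id
  simpa only [← sq] using hY.integral_dotProduct_mul_dotProduct hc hc hpair

theorem IsWhiteNoise.integral_const_dotProduct_sq [IsProbabilityMeasure P]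
    (hY : IsWhiteNoise Y σ P) (x : ι → ℝ) : ∫ ω, (x ⬝ᵥ Y ω) ^ 2 ∂P = σ * (x ⬝ᵥ x) := by
  have h := hY.integral_dotProduct_sq (c := fun _ => x) (fun s => memLp_const _)
    (indepFun_const_left x Y)
  simpa only [integral_const, probReal_univ, one_smul] using h

end WhiteNoise

section Gram

variable {ι κ : Type*} [Fintype ι] [DecidableEq κ]

/-- The deviation of the Gram matrix `gᵀ * g` from `card ι * μ`, where the squared entries on the
diagonal are truncated at `1`. The truncation gives the diagonal a finite variance when the entries
of `g` are random with only two moments, and it can only decrease `gᵀ * g`. -/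
def truncGramDev (μ : ℝ) (g : Matrix ι κ ℝ) : Matrix κ κ ℝ :=
  of fun k l => ∑ a, if k = l then min (g a k ^ 2) 1 - μ else g a k * g a l

variable [Fintype κ] {μ : ℝ} (g : Matrix ι κ ℝ)

theorem add_dotProduct_truncGramDev_mulVec_le (y : κ → ℝ) :
    Fintype.card ι * μ * (y ⬝ᵥ y) + y ⬝ᵥ truncGramDev μ g *ᵥ y ≤ (g *ᵥ y) ⬝ᵥ (g *ᵥ y) := by
  have hentry (a : ι) (k l : κ) :
      (if k = l then μ * y k ^ 2 else 0)
        + y k * ((if k = l then min (g a k ^ 2) 1 - μ else g a k * g a l) * y l)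
        ≤ (g a k * y k) * (g a l * y l) := by
    split_ifs with h
    · subst h
      nlinarith [mul_le_mul_of_nonneg_right (min_le_left (g a k ^ 2) 1) (sq_nonneg (y k))]
    · exact le_of_eq (by ring)
  calc Fintype.card ι * μ * (y ⬝ᵥ y) + y ⬝ᵥ truncGramDev μ g *ᵥ y
      = ∑ a, ∑ k, ∑ l, ((if k = l then μ * y k ^ 2 else 0)
          + y k * ((if k = l then min (g a k ^ 2) 1 - μ else g a k * g a l) * y l)) := by
        simp only [Finset.sum_add_distrib, Finset.sum_ite_eq, Finset.mem_univ, if_true,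
          ← Finset.mul_sum, Finset.sum_const, Finset.card_univ, nsmul_eq_mul, dotProduct, mulVec,
          truncGramDev, of_apply, Finset.sum_mul, sq, mul_assoc]
        congr 1
        · ring
        · rw [Finset.sum_comm]
          refine Finset.sum_congr rfl fun k _ => ?_
          rw [← Finset.mul_sum, Finset.sum_comm]
    _ ≤ ∑ a, ∑ k, ∑ l, (g a k * y k) * (g a l * y l) :=
        Finset.sum_le_sum fun a _ => Finset.sum_le_sum fun k _ => Finset.sum_le_sum fun l _ =>
          hentry a k l
    _ = (g *ᵥ y) ⬝ᵥ (g *ᵥ y) := by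
        simp only [dotProduct, mulVec, Finset.sum_mul_sum]

theorem half_mul_dotProduct_self_le_of_truncGramDev_le [Nonempty ι] (hμ : 0 < μ)
    (hE : vec (truncGramDev μ g) ⬝ᵥ vec (truncGramDev μ g) ≤ (Fintype.card ι * μ / 2) ^ 2)
    (y : κ → ℝ) :
    Fintype.card ι * μ / 2 * (y ⬝ᵥ y) ≤ (g *ᵥ y) ⬝ᵥ (g *ᵥ y) := by
  have hy := dotProduct_self_nonneg y
  have hsq : (y ⬝ᵥ truncGramDev μ g *ᵥ y) ^ 2 ≤ (Fintype.card ι * μ / 2 * (y ⬝ᵥ y)) ^ 2 :=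
    (dotProduct_mulVec_self_sq_le _ y).trans (by rw [mul_pow]; gcongr)
  have hdev := (abs_le_of_sq_le_sq' hsq (by positivity)).1
  linarith [add_dotProduct_truncGramDev_mulVec_le (μ := μ) g y]

variable {g} {Q : Matrix ι κ ℝ} {R : Matrix κ κ ℝ}

/-- Either the deviation is small and the columns of `g` are well conditioned, or it is large and
Bessel's inequality suffices. -/
theorem transpose_mulVec_dotProduct_self_le_add_truncGramDev [Nonempty ι] (hμ : 0 < μ)
    (hQ : Qᵀ * Q = 1) (hg : g = Q * R) (x : ι → ℝ) :
    (Qᵀ *ᵥ x) ⬝ᵥ (Qᵀ *ᵥ x) ≤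
      (Fintype.card ι * μ / 2)⁻¹ * ((gᵀ *ᵥ x) ⬝ᵥ (gᵀ *ᵥ x))
        + ((Fintype.card ι * μ / 2) ^ 2)⁻¹ * (x ⬝ᵥ x)
          * (vec (truncGramDev μ g) ⬝ᵥ vec (truncGramDev μ g)) := by
  have hc : 0 < Fintype.card ι * μ / 2 := by positivity
  set c := Fintype.card ι * μ / 2
  have hx := dotProduct_self_nonneg x
  have hgx := dotProduct_self_nonneg (gᵀ *ᵥ x)
  have hE0 := dotProduct_self_nonneg (vec (truncGramDev μ g))
  rcases le_total (vec (truncGramDev μ g) ⬝ᵥ vec (truncGramDev μ g)) (c ^ 2) with hE | hE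
  · have h := transpose_mulVec_dotProduct_self_le_of_eq_mul hQ hg hc
      (half_mul_dotProduct_self_le_of_truncGramDev_le g hμ hE) x
    rw [← le_inv_mul_iff₀ hc] at h
    exact h.trans (le_add_of_nonneg_right (by positivity))
  · refine (transpose_mulVec_dotProduct_self_le hQ x).trans ?_
    refine le_add_of_nonneg_of_le (by positivity) ?_
    rw [mul_assoc, le_inv_mul_iff₀ (by positivity), mul_comm]
    gcongr

end Gram

section IndependentEntries

/-- The second moment of `ν` truncated at `1`; unlike the second moment, it is the mean of a bounded
random variable. -/
def truncSecondMoment (ν : Measure ℝ) : ℝ := ∫ x, min (x ^ 2) 1 ∂ν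

theorem integrable_min_sq_one (ν : Measure ℝ) [IsFiniteMeasure ν] :
    Integrable (fun x : ℝ => min (x ^ 2) 1) ν :=
  Integrable.of_bound (by fun_prop) 1 <| .of_forall fun x => by
    rw [Real.norm_of_nonneg (le_min (sq_nonneg x) zero_le_one)]
    exact min_le_right _ _

theorem truncSecondMoment_pos {ν : Measure ℝ} [IsProbabilityMeasure ν]
    (hν : ν ≠ Measure.dirac 0) : 0 < truncSecondMoment ν := by
  have hnonneg (x : ℝ) : 0 ≤ min (x ^ 2) 1 := le_min (sq_nonneg x) zero_le_one
  refine (integral_nonneg hnonneg).lt_of_ne fun h => hν ?_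
  have hzero := (integral_eq_zero_iff_of_nonneg hnonneg (integrable_min_sq_one ν)).mp h.symm
  have hid : (id : ℝ → ℝ) =ᵐ[ν] fun _ => 0 := by
    filter_upwards [hzero] with x hx
    rcases min_eq_iff.mp hx with ⟨h0, -⟩ | ⟨h1, -⟩
    · exact pow_eq_zero_iff two_ne_zero |>.mp h0
    · exact absurd h1 one_ne_zero
  simpa only [Measure.map_id] using (hasLaw_dirac_of_ae_eq hid).map_eq

theorem integral_min_sq_sub_truncSecondMoment_sq_le (ν : Measure ℝ) [IsProbabilityMeasure ν] :
    ∫ x, (min (x ^ 2) 1 - truncSecondMoment ν) ^ 2 ∂ν ≤ 1 := by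
  have hle (x : ℝ) : min (x ^ 2) 1 ∈ Set.Icc 0 1 :=
    ⟨le_min (sq_nonneg x) zero_le_one, min_le_right _ _⟩
  have hμ : truncSecondMoment ν ∈ Set.Icc 0 1 := by
    refine ⟨integral_nonneg fun x => (hle x).1, ?_⟩
    have h := integral_mono (integrable_min_sq_one ν) (integrable_const 1) fun x => (hle x).2
    rwa [integral_const, probReal_univ, one_smul] at h
  have hbound (x : ℝ) : (min (x ^ 2) 1 - truncSecondMoment ν) ^ 2 ≤ 1 := by
    rw [sq_le_one_iff_abs_le_one, abs_le]
    constructor <;> linarith [(hle x).1, (hle x).2, hμ.1, hμ.2]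
  simpa only [integral_const, probReal_univ, one_smul] using
    integral_mono_of_nonneg (μ := ν) (.of_forall fun x => sq_nonneg _) (integrable_const 1)
      (.of_forall hbound)

variable {Ω ι κ : Type*} [MeasurableSpace Ω] {P : Measure Ω} {ν : Measure ℝ}
  {g : Ω → Matrix ι κ ℝ}

/-- A random matrix with independent entries of law `ν`. -/
structure HasIIDEntries (g : Ω → Matrix ι κ ℝ) (ν : Measure ℝ) (P : Measure Ω) : Prop where
  hasLaw : ∀ a k, HasLaw (fun ω => g ω a k) ν P
  iIndepFun : iIndepFun (fun (s : ι × κ) ω => g ω s.1 s.2) P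

namespace HasIIDEntries

theorem memLp_comp (hg : HasIIDEntries g ν P) {f : ℝ → ℝ} (hf : MemLp f 2 ν) (a : ι) (k : κ) :
    MemLp (fun ω => f (g ω a k)) 2 P := by
  rw [← (hg.hasLaw a k).map_eq] at hf
  exact hf.comp_of_map (hg.hasLaw a k).aemeasurable

theorem integral_comp (hg : HasIIDEntries g ν P) {f : ℝ → ℝ} (hf : AEStronglyMeasurable f ν)
    (a : ι) (k : κ) : ∫ ω, f (g ω a k) ∂P = ∫ x, f x ∂ν :=
  (hg.hasLaw a k).integral_comp hf

theorem isWhiteNoise_comp_col (hg : HasIIDEntries g ν P) {f : ℝ → ℝ} (hf : Measurable f)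
    (hfL : MemLp f 2 ν) (hmean : ∫ x, f x ∂ν = 0) (k : κ) :
    IsWhiteNoise (fun ω a => f (g ω a k)) (∫ x, f x ^ 2 ∂ν) P :=
  .of_pairwise_indepFun (fun a => hg.memLp_comp hfL a k)
    (fun a b hab => (hg.iIndepFun.indepFun (i := (a, k)) (j := (b, k))
      fun h => hab (congrArg Prod.fst h)).comp hf hf)
    (fun a => (hg.integral_comp hfL.1 a k).trans hmean)
    (fun a => hg.integral_comp (f := fun x => f x ^ 2) (by fun_prop) a k)

theorem isWhiteNoise_mul_col (hg : HasIIDEntries g ν P) (hν : MemLp id 2 ν)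
    (hmean : ∫ x, x ∂ν = 0) {k l : κ} (hkl : k ≠ l) :
    IsWhiteNoise (fun ω a => g ω a k * g ω a l) ((∫ x, x ^ 2 ∂ν) ^ 2) P := by
  have hmem := hg.memLp_comp hν
  have hindep (a : ι) : IndepFun (fun ω => g ω a k) (fun ω => g ω a l) P :=
    hg.iIndepFun.indepFun (i := (a, k)) (j := (a, l)) fun h => hkl (congrArg Prod.snd h)
  have hmean0 (a : ι) : ∫ ω, g ω a k ∂P = 0 := (hg.integral_comp hν.1 a k).trans hmean
  have hmeas (s : ι × κ) : AEMeasurable (fun ω => g ω s.1 s.2) P :=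
    (hg.hasLaw s.1 s.2).aemeasurable
  refine .of_pairwise_indepFun
    (fun a => memLp_two_mul_of_indepFun (hmem a k) (hmem a l) (hindep a)) (fun a b hab => ?_)
    (fun a => ?_) (fun a => ?_)
  · exact hg.iIndepFun.indepFun_mul_mul₀ hmeas (a, k) (a, l) (b, k) (b, l) (by simp [hab])
      (by simp [hab]) (by simp [hab]) (by simp [hab])
  · rw [(hindep a).integral_fun_mul_eq_mul_integral (hmem a k).1 (hmem a l).1,
        hmean0 a, zero_mul]
  · have hsq : IndepFun (fun ω => g ω a k ^ 2) (fun ω => g ω a l ^ 2) P :=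
      (hindep a).comp (φ := (· ^ 2)) (ψ := (· ^ 2)) (by fun_prop) (by fun_prop)
    have hint (k : κ) : ∫ ω, g ω a k ^ 2 ∂P = ∫ x, x ^ 2 ∂ν :=
      hg.integral_comp (f := (· ^ 2)) (by fun_prop) a k
    simp only [mul_pow]
    rw [hsq.integral_fun_mul_eq_mul_integral ((hmem a k).1.pow 2) ((hmem a l).1.pow 2), hint k,
      hint l, sq]

section Gram

variable [DecidableEq κ] [IsProbabilityMeasure ν]

theorem exists_isWhiteNoise_truncGramDev (hg : HasIIDEntries g ν P) (hν : MemLp id 2 ν)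
    (hmean : ∫ x, x ∂ν = 0) (k l : κ) :
    ∃ σ ≤ 1 + (∫ x, x ^ 2 ∂ν) ^ 2,
      IsWhiteNoise (fun ω a => if k = l then min (g ω a k ^ 2) 1 - truncSecondMoment ν
        else g ω a k * g ω a l) σ P := by
  by_cases hkl : k = l
  · have hmem : MemLp (fun x : ℝ => min (x ^ 2) 1) 2 ν :=
      MemLp.of_bound (by fun_prop) 1 <| .of_forall fun x => by
        rw [Real.norm_of_nonneg (le_min (sq_nonneg x) zero_le_one)]
        exact min_le_right _ _
    refine ⟨∫ x, (min (x ^ 2) 1 - truncSecondMoment ν) ^ 2 ∂ν, ?_, ?_⟩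
    · exact (integral_min_sq_sub_truncSecondMoment_sq_le ν).trans
        (le_add_of_nonneg_right (sq_nonneg _))
    · simp only [hkl, if_true]
      refine hg.isWhiteNoise_comp_col (f := fun x => min (x ^ 2) 1 - truncSecondMoment ν)
        (by fun_prop) (hmem.sub (memLp_const _)) ?_ l
      rw [integral_sub (integrable_min_sq_one ν) (integrable_const _), integral_const,
        probReal_univ, one_smul, truncSecondMoment, sub_self]
  · refine ⟨(∫ x, x ^ 2 ∂ν) ^ 2, le_add_of_nonneg_left zero_le_one, ?_⟩
    simpa only [hkl, if_false] using hg.isWhiteNoise_mul_col hν hmean hkl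

variable [Fintype ι] [IsProbabilityMeasure P]

theorem integrable_and_integral_truncGramDev_sq_le (hg : HasIIDEntries g ν P) (hν : MemLp id 2 ν)
    (hmean : ∫ x, x ∂ν = 0) (k l : κ) :
    Integrable (fun ω => truncGramDev (truncSecondMoment ν) (g ω) k l ^ 2) P ∧
      ∫ ω, truncGramDev (truncSecondMoment ν) (g ω) k l ^ 2 ∂P
        ≤ (1 + (∫ x, x ^ 2 ∂ν) ^ 2) * Fintype.card ι := by
  obtain ⟨σ, hσ, hY⟩ := hg.exists_isWhiteNoise_truncGramDev hν hmean k l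
  simp only [truncGramDev, of_apply]
  refine ⟨(memLp_finsetSum _ fun a _ => hY.memLp a).integrable_sq, ?_⟩
  have h := hY.integral_const_dotProduct_sq 1
  simp only [one_dotProduct, Pi.one_apply, Finset.sum_const, Finset.card_univ, nsmul_one] at h
  rw [h]
  gcongr

theorem integrable_and_integral_truncGramDev_le [Fintype κ] (hg : HasIIDEntries g ν P)
    (hν : MemLp id 2 ν) (hmean : ∫ x, x ∂ν = 0) :
    Integrable (fun ω => vec (truncGramDev (truncSecondMoment ν) (g ω)) ⬝ᵥ
        vec (truncGramDev (truncSecondMoment ν) (g ω))) P ∧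
      ∫ ω, vec (truncGramDev (truncSecondMoment ν) (g ω)) ⬝ᵥ
        vec (truncGramDev (truncSecondMoment ν) (g ω)) ∂P
        ≤ Fintype.card κ ^ 2 * ((1 + (∫ x, x ^ 2 ∂ν) ^ 2) * Fintype.card ι) := by
  have hentry (s : κ × κ) := hg.integrable_and_integral_truncGramDev_sq_le hν hmean s.2 s.1
  simp only [dotProduct, vec, ← sq]
  refine ⟨integrable_finsetSum _ fun s _ => (hentry s).1, ?_⟩
  rw [integral_finsetSum _ fun s _ => (hentry s).1]
  refine (Finset.sum_le_card_nsmul _ _ _ fun s _ => (hentry s).2).trans_eq ?_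
  rw [nsmul_eq_mul, Finset.card_univ, Fintype.card_prod, Nat.cast_mul, ← sq]

end Gram

theorem integrable_and_integral_transpose_mulVec [Fintype ι] [Fintype κ]
    [IsProbabilityMeasure P] (hg : HasIIDEntries g ν P) (hν : MemLp id 2 ν)
    (hmean : ∫ x, x ∂ν = 0) (x : ι → ℝ) :
    Integrable (fun ω => ((g ω)ᵀ *ᵥ x) ⬝ᵥ ((g ω)ᵀ *ᵥ x)) P ∧
      ∫ ω, ((g ω)ᵀ *ᵥ x) ⬝ᵥ ((g ω)ᵀ *ᵥ x) ∂P
        = Fintype.card κ * (∫ x, x ^ 2 ∂ν) * (x ⬝ᵥ x) := by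
  have hcol (k : κ) : IsWhiteNoise (fun ω a => g ω a k) (∫ x, x ^ 2 ∂ν) P :=
    hg.isWhiteNoise_comp_col measurable_id hν hmean k
  have hexp (ω : Ω) : ((g ω)ᵀ *ᵥ x) ⬝ᵥ ((g ω)ᵀ *ᵥ x) = ∑ k, (x ⬝ᵥ fun a => g ω a k) ^ 2 := by
    simp only [dotProduct, mulVec, transpose_apply, sq, mul_comm (x _)]
  have hint (k : κ) : Integrable (fun ω => (x ⬝ᵥ fun a => g ω a k) ^ 2) P :=
    ((hcol k).memLp_dotProduct (c := fun _ => x) (fun _ => memLp_const _)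
      (indepFun_const_left x _)).integrable_sq
  simp only [hexp]
  refine ⟨integrable_finsetSum _ fun k _ => hint k, ?_⟩
  rw [integral_finsetSum _ fun k _ => hint k,
    Finset.sum_congr rfl fun k _ => (hcol k).integral_const_dotProduct_sq x]
  simp only [Finset.sum_const, Finset.card_univ, nsmul_eq_mul, mul_assoc]

end HasIIDEntries

/-- The delocalization constant of the first `r` orthogonal factors of a random matrix with entries
of law `ν`: such factors have mean squared component at most `qrDelocConst ν r / m` along any unit
vector of dimension `m`. -/
def qrDelocConst (ν : Measure ℝ) (r : ℕ) : ℝ :=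
  2 * r * (∫ x, x ^ 2 ∂ν) / truncSecondMoment ν
    + 4 * r ^ 2 * (1 + (∫ x, x ^ 2 ∂ν) ^ 2) / truncSecondMoment ν ^ 2

theorem qrDelocConst_nonneg (ν : Measure ℝ) (r : ℕ) : 0 ≤ qrDelocConst ν r := by
  have hμ : 0 ≤ truncSecondMoment ν := integral_nonneg fun x => le_min (sq_nonneg x) zero_le_one
  unfold qrDelocConst
  positivity

theorem HasIIDEntries.integral_qr_transpose_mulVec_le [Fintype ι] [Nonempty ι] [Fintype κ]
    [DecidableEq κ] [IsProbabilityMeasure P] [IsProbabilityMeasure ν] (hg : HasIIDEntries g ν P)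
    (hν : MemLp id 2 ν) (hmean : ∫ x, x ∂ν = 0) (hν0 : ν ≠ Measure.dirac 0)
    {Q : Ω → Matrix ι κ ℝ} {R : Ω → Matrix κ κ ℝ} (hQ : ∀ ω, (Q ω)ᵀ * Q ω = 1)
    (hgQ : ∀ ω, g ω = Q ω * R ω) (x : ι → ℝ) :
    ∫ ω, ((Q ω)ᵀ *ᵥ x) ⬝ᵥ ((Q ω)ᵀ *ᵥ x) ∂P
      ≤ qrDelocConst ν (Fintype.card κ) / Fintype.card ι * (x ⬝ᵥ x) := by
  have hμ := truncSecondMoment_pos hν0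
  have hx := dotProduct_self_nonneg x
  obtain ⟨hgint, hgval⟩ := hg.integrable_and_integral_transpose_mulVec hν hmean x
  obtain ⟨hEint, hEval⟩ := hg.integrable_and_integral_truncGramDev_le hν hmean
  have hm : (Fintype.card ι : ℝ) ≠ 0 := Nat.cast_ne_zero.mpr Fintype.card_ne_zero
  have hμ0 : truncSecondMoment ν ≠ 0 := hμ.ne'
  set m := (Fintype.card ι : ℝ)
  set μ := truncSecondMoment ν with hμ_def
  calc ∫ ω, ((Q ω)ᵀ *ᵥ x) ⬝ᵥ ((Q ω)ᵀ *ᵥ x) ∂P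
      ≤ ∫ ω, ((m * μ / 2)⁻¹ * (((g ω)ᵀ *ᵥ x) ⬝ᵥ ((g ω)ᵀ *ᵥ x)) + ((m * μ / 2) ^ 2)⁻¹ * (x ⬝ᵥ x)
          * (vec (truncGramDev μ (g ω)) ⬝ᵥ vec (truncGramDev μ (g ω)))) ∂P :=
        integral_mono_of_nonneg (.of_forall fun ω => dotProduct_self_nonneg _)
          ((hgint.const_mul _).add (hEint.const_mul _)) (.of_forall fun ω =>
            transpose_mulVec_dotProduct_self_le_add_truncGramDev hμ (hQ ω) (hgQ ω) x)
    _ = (m * μ / 2)⁻¹ * (Fintype.card κ * (∫ x, x ^ 2 ∂ν) * (x ⬝ᵥ x))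
          + ((m * μ / 2) ^ 2)⁻¹ * (x ⬝ᵥ x) * ∫ ω, vec (truncGramDev μ (g ω)) ⬝ᵥ
            vec (truncGramDev μ (g ω)) ∂P := by
        rw [integral_add (hgint.const_mul _) (hEint.const_mul _), integral_const_mul,
          integral_const_mul, hgval]
    _ ≤ (m * μ / 2)⁻¹ * (Fintype.card κ * (∫ x, x ^ 2 ∂ν) * (x ⬝ᵥ x))
          + ((m * μ / 2) ^ 2)⁻¹ * (x ⬝ᵥ x)
            * (Fintype.card κ ^ 2 * ((1 + (∫ x, x ^ 2 ∂ν) ^ 2) * m)) := by gcongr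
    _ = qrDelocConst ν (Fintype.card κ) / m * (x ⬝ᵥ x) := by
        simp only [qrDelocConst, ← hμ_def]
        field_simp
        ring

end IndependentEntries

section Perturbation

variable {ι κ ρ α β : Type*} [Fintype ι] [Fintype κ] [Fintype α] [Fintype β]

theorem transpose_mulVec_dotProduct_self_le_of_mulVec {S : Matrix ι α ℝ} {K : ℝ} (hK : 0 ≤ K)
    (hS : ∀ y, (S *ᵥ y) ⬝ᵥ (S *ᵥ y) ≤ K * (y ⬝ᵥ y)) (x : ι → ℝ) :
    (Sᵀ *ᵥ x) ⬝ᵥ (Sᵀ *ᵥ x) ≤ K * (x ⬝ᵥ x) := by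
  set t := (Sᵀ *ᵥ x) ⬝ᵥ (Sᵀ *ᵥ x) with ht
  have hx := dotProduct_self_nonneg x
  have hsq : t ^ 2 ≤ K * (x ⬝ᵥ x) * t := by
    calc t ^ 2 = (x ⬝ᵥ S *ᵥ (Sᵀ *ᵥ x)) ^ 2 := by rw [ht, dotProduct_mulVec x, ← mulVec_transpose]
      _ ≤ (x ⬝ᵥ x) * (K * t) :=
        (dotProduct_sq_le _ _).trans (mul_le_mul_of_nonneg_left (hS _) hx)
      _ = K * (x ⬝ᵥ x) * t := by ring
  rcases (dotProduct_self_nonneg (Sᵀ *ᵥ x)).eq_or_lt with h0 | hpos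
  · rw [ht, ← h0]
    positivity
  · exact le_of_mul_le_mul_right (by rwa [← sq]) hpos

theorem vec_dotProduct_self_eq_sum_col (M : Matrix ι κ ℝ) :
    vec M ⬝ᵥ vec M = ∑ k, M.col k ⬝ᵥ M.col k :=
  Fintype.sum_prod_type _

theorem vec_mul_dotProduct_vec_mul_le {A : Matrix ι α ℝ} {K : ℝ}
    (hA : ∀ y, (A *ᵥ y) ⬝ᵥ (A *ᵥ y) ≤ K * (y ⬝ᵥ y)) (M : Matrix α κ ℝ) :
    vec (A * M) ⬝ᵥ vec (A * M) ≤ K * (vec M ⬝ᵥ vec M) := by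
  rw [vec_dotProduct_self_eq_sum_col, vec_dotProduct_self_eq_sum_col, Finset.mul_sum]
  exact Finset.sum_le_sum fun k _ => hA (M.col k)

theorem dotProduct_mul_mul_mulVec (S : Matrix ι α ℝ) (X : Matrix α β ℝ) (T : Matrix β κ ℝ)
    (x : ι → ℝ) (y : κ → ℝ) :
    x ⬝ᵥ (S * X * T) *ᵥ y = vec (vecMulVec (Sᵀ *ᵥ x) (T *ᵥ y)) ⬝ᵥ vec X := by
  rw [dotProduct_comm (vec _), vec_dotProduct_vec_vecMulVec, ← mulVec_mulVec, ← mulVec_mulVec,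
    dotProduct_mulVec, mulVec_transpose]

/-- Quantitative assumptions on the deterministic data of a perturbation: `K` bounds the squared
operator norms of the factors `S`, `T` of the noise `S * X * T`, the singular values and the inverse
of the `i`-th one, and `L` bounds the inverse gaps `δ`. -/
structure PerturbationBounds (d δ : ρ → ℝ) (i : ρ) (S : Matrix ι α ℝ) (T : Matrix β κ ℝ)
    (K L : ℝ) : Prop where
  nonneg : 0 ≤ K
  left : ∀ y, (S *ᵥ y) ⬝ᵥ (S *ᵥ y) ≤ K * (y ⬝ᵥ y)
  right : ∀ y, (T *ᵥ y) ⬝ᵥ (T *ᵥ y) ≤ K * (y ⬝ᵥ y)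
  abs_le : ∀ j, |d j| ≤ K
  abs_inv_le : |(d i)⁻¹| ≤ K
  abs_invGap_le : ∀ j, |δ j| ≤ L

variable {d δ : ρ → ℝ} {i : ρ} {S : Matrix ι α ℝ} {T : Matrix β κ ℝ} {K L : ℝ}

theorem PerturbationBounds.transpose_left_le
    (h : PerturbationBounds d δ i S T K L) (y : ι → ℝ) :
    (Sᵀ *ᵥ y) ⬝ᵥ (Sᵀ *ᵥ y) ≤ K * (y ⬝ᵥ y) :=
  transpose_mulVec_dotProduct_self_le_of_mulVec h.nonneg h.left y

theorem PerturbationBounds.left_mul_transpose_le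
    (h : PerturbationBounds d δ i S T K L) (y : ι → ℝ) :
    (S *ᵥ (Sᵀ *ᵥ y)) ⬝ᵥ (S *ᵥ (Sᵀ *ᵥ y)) ≤ K ^ 2 * (y ⬝ᵥ y) := by
  rw [sq, mul_assoc]
  exact (h.left _).trans (mul_le_mul_of_nonneg_left (h.transpose_left_le y) h.nonneg)

theorem PerturbationBounds.right_col_le [DecidableEq ρ] {v : Matrix κ ρ ℝ}
    (h : PerturbationBounds d δ i S T K L) (hv : vᵀ * v = 1) :
    (T *ᵥ v.col i) ⬝ᵥ (T *ᵥ v.col i) ≤ K := by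
  have hcol : v.col i ⬝ᵥ v.col i = 1 := (congrFun (congrFun hv i) i).trans (one_apply_eq i)
  simpa only [hcol, mul_one] using h.right (v.col i)

variable [Fintype ρ]

/-- The component orthogonal to the signal subspace of the first-order perturbation of the singular
vector `u i`. The frames `u`, `v` hold the left and right singular vectors of the signal, `d` its
singular values, and `Z` is the noise. -/
def noisePart [DecidableEq ι] (d : ρ → ℝ) (i : ρ) (u : Matrix ι ρ ℝ) (v : Matrix κ ρ ℝ)
    (Z : Matrix ι κ ℝ) : ι → ℝ :=
  (d i)⁻¹ • (((1 - u * uᵀ) * Z) *ᵥ v.col i)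

/-- For noise `S * X * T`, the coefficient matrix in `X` of the linear form `x ⬝ᵥ noisePart …`. -/
def noiseCoeff (d : ρ → ℝ) (i : ρ) (S : Matrix ι α ℝ) (T : Matrix β κ ℝ) (x : ι → ℝ)
    (u : Matrix ι ρ ℝ) (v : Matrix κ ρ ℝ) : Matrix α β ℝ :=
  (d i)⁻¹ • vecMulVec (Sᵀ *ᵥ (x - u *ᵥ (uᵀ *ᵥ x))) (T *ᵥ v.col i)

theorem dotProduct_noisePart [DecidableEq ι] (d : ρ → ℝ) (i : ρ) (S : Matrix ι α ℝ)
    (T : Matrix β κ ℝ) (x : ι → ℝ) (u : Matrix ι ρ ℝ) (v : Matrix κ ρ ℝ) (X : Matrix α β ℝ) :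
    x ⬝ᵥ noisePart d i u v (S * X * T) = vec (noiseCoeff d i S T x u v) ⬝ᵥ vec X := by
  have hproj : x ⬝ᵥ ((1 - u * uᵀ) * (S * X * T)) *ᵥ v.col i
      = (x - u *ᵥ (uᵀ *ᵥ x)) ⬝ᵥ (S * X * T) *ᵥ v.col i := by
    rw [← mulVec_mulVec, dotProduct_mulVec, ← mulVec_transpose, transpose_sub, transpose_one,
      transpose_mul, transpose_transpose, sub_mulVec, one_mulVec, ← mulVec_mulVec]
  rw [noisePart, dotProduct_smul, hproj, dotProduct_mul_mul_mulVec, noiseCoeff, vec_smul,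
    smul_dotProduct]

variable [DecidableEq ρ]

theorem diagonal_mulVec_dotProduct_self_le {δ : ρ → ℝ} {L : ℝ} (hδ : ∀ j, |δ j| ≤ L)
    (y : ρ → ℝ) : (diagonal δ *ᵥ y) ⬝ᵥ (diagonal δ *ᵥ y) ≤ L ^ 2 * (y ⬝ᵥ y) := by
  simp only [dotProduct, mulVec_diagonal, Finset.mul_sum, ← sq, mul_pow]
  gcongr ∑ j, ?_ * _ with j
  exact sq_le_sq.mpr ((hδ j).trans (le_abs_self L))

/-- The component inside the signal subspace, the column span of `u`, of the first-order
perturbation of the singular vector `u i`. The entry `δ j` stands for `1 / (d i ^ 2 - d j ^ 2)`; the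
rest of the notation is that of `noisePart`. -/
def signalPart (d δ : ρ → ℝ) (i : ρ) (u : Matrix ι ρ ℝ) (v : Matrix κ ρ ℝ) (Z : Matrix ι κ ℝ) :
    ι → ℝ :=
  d i • ((u * diagonal δ * uᵀ * Z) *ᵥ v.col i)
    + (u * diagonal δ * diagonal d * vᵀ * Zᵀ) *ᵥ u.col i

/-- The small factor of `signalCoeff`, of size `|uᵀ x|`. -/
def signalCore (d δ : ρ → ℝ) (i : ρ) (T : Matrix β κ ℝ) (x : ι → ℝ) (u : Matrix ι ρ ℝ)
    (v : Matrix κ ρ ℝ) : Matrix ρ β ℝ :=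
  vecMulVec (d i • diagonal δ *ᵥ (uᵀ *ᵥ x)) (T *ᵥ v.col i)
    + vecMulVec (Pi.single i 1) (T *ᵥ (v *ᵥ (diagonal d *ᵥ (diagonal δ *ᵥ (uᵀ *ᵥ x)))))

/-- For noise `S * X * T`, the coefficient matrix in `X` of the linear form `x ⬝ᵥ signalPart …`. -/
def signalCoeff (d δ : ρ → ℝ) (i : ρ) (S : Matrix ι α ℝ) (T : Matrix β κ ℝ) (x : ι → ℝ)
    (u : Matrix ι ρ ℝ) (v : Matrix κ ρ ℝ) : Matrix α β ℝ :=
  Sᵀ * u * signalCore d δ i T x u v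

theorem dotProduct_signalPart (d δ : ρ → ℝ) (i : ρ) (S : Matrix ι α ℝ) (T : Matrix β κ ℝ)
    (x : ι → ℝ) (u : Matrix ι ρ ℝ) (v : Matrix κ ρ ℝ) (X : Matrix α β ℝ) :
    x ⬝ᵥ signalPart d δ i u v (S * X * T) = vec (signalCoeff d δ i S T x u v) ⬝ᵥ vec X := by
  set Z := S * X * T with hZ
  have hfst : x ⬝ᵥ (u * diagonal δ * uᵀ * Z) *ᵥ v.col i
      = (u *ᵥ (diagonal δ *ᵥ (uᵀ *ᵥ x))) ⬝ᵥ Z *ᵥ v.col i := by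
    simp only [← mulVec_mulVec, dotProduct_mulVec, ← mulVec_transpose, diagonal_transpose,
      transpose_transpose]
  have hsnd : x ⬝ᵥ (u * diagonal δ * diagonal d * vᵀ * Zᵀ) *ᵥ u.col i
      = u.col i ⬝ᵥ Z *ᵥ (v *ᵥ (diagonal d *ᵥ (diagonal δ *ᵥ (uᵀ *ᵥ x)))) := by
    rw [dotProduct_mulVec, ← mulVec_transpose, dotProduct_comm]
    simp only [transpose_mul, diagonal_transpose, transpose_transpose, ← mulVec_mulVec]
  rw [signalPart, dotProduct_add, dotProduct_smul, hfst, hsnd, hZ, dotProduct_mul_mul_mulVec,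
    dotProduct_mul_mul_mulVec, signalCoeff, signalCore, Matrix.mul_add, mul_vecMulVec,
    mul_vecMulVec, vec_add, add_dotProduct, ← mulVec_mulVec, ← mulVec_mulVec, mulVec_single_one,
    mulVec_smul, mulVec_smul, smul_vecMulVec, vec_smul, smul_dotProduct]

theorem signalCoeff_dotProduct_noiseCoeff (d δ : ρ → ℝ) (i : ρ) (S : Matrix ι α ℝ)
    (T : Matrix β κ ℝ) (x : ι → ℝ) (u : Matrix ι ρ ℝ) (v : Matrix κ ρ ℝ) :
    vec (signalCoeff d δ i S T x u v) ⬝ᵥ vec (noiseCoeff d i S T x u v)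
      = (d i)⁻¹ * (vec (signalCore d δ i T x u v) ⬝ᵥ
        vec (vecMulVec (uᵀ *ᵥ (S *ᵥ (Sᵀ *ᵥ (x - u *ᵥ (uᵀ *ᵥ x))))) (T *ᵥ v.col i))) := by
  rw [noiseCoeff, vec_smul, dotProduct_smul, smul_eq_mul, vec_dotProduct_vec_vecMulVec,
    vec_dotProduct_vec_vecMulVec, signalCoeff, ← mulVec_mulVec, dotProduct_mulVec,
    ← mulVec_transpose, transpose_mul, transpose_transpose, ← mulVec_mulVec]

namespace PerturbationBounds

variable {u : Matrix ι ρ ℝ} {v : Matrix κ ρ ℝ}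

theorem right_mulVec_le (h : PerturbationBounds d δ i S T K L) (hv : vᵀ * v = 1) (y : ρ → ℝ) :
    (T *ᵥ (v *ᵥ y)) ⬝ᵥ (T *ᵥ (v *ᵥ y)) ≤ K * (y ⬝ᵥ y) := by
  simpa only [mulVec_dotProduct_mulVec hv] using h.right (v *ᵥ y)

theorem signalCore_le (h : PerturbationBounds d δ i S T K L) (hv : vᵀ * v = 1) (x : ι → ℝ) :
    vec (signalCore d δ i T x u v) ⬝ᵥ vec (signalCore d δ i T x u v)
      ≤ 4 * K ^ 3 * L ^ 2 * ((uᵀ *ᵥ x) ⬝ᵥ (uᵀ *ᵥ x)) := by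
  have hK := h.nonneg
  set q := (uᵀ *ᵥ x) ⬝ᵥ (uᵀ *ᵥ x)
  set y := diagonal δ *ᵥ (uᵀ *ᵥ x)
  have hy : y ⬝ᵥ y ≤ L ^ 2 * q := diagonal_mulVec_dotProduct_self_le h.abs_invGap_le _
  have hdy : (d i • y) ⬝ᵥ (d i • y) ≤ K ^ 2 * (L ^ 2 * q) := by
    rw [smul_dotProduct_smul_self]
    exact mul_le_mul (sq_le_sq.mpr ((h.abs_le i).trans (le_abs_self K))) hy
      (dotProduct_self_nonneg y) (sq_nonneg K)
  have hTy : (T *ᵥ (v *ᵥ (diagonal d *ᵥ y))) ⬝ᵥ (T *ᵥ (v *ᵥ (diagonal d *ᵥ y)))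
      ≤ K * (K ^ 2 * (L ^ 2 * q)) :=
    (h.right_mulVec_le hv _).trans (mul_le_mul_of_nonneg_left
      ((diagonal_mulVec_dotProduct_self_le h.abs_le y).trans
        (mul_le_mul_of_nonneg_left hy (sq_nonneg K))) hK)
  have hfst := mul_le_mul hdy (h.right_col_le hv) (dotProduct_self_nonneg _)
    ((dotProduct_self_nonneg _).trans hdy)
  rw [signalCore, vec_add]
  refine (add_dotProduct_self_le _ _).trans ?_
  rw [vec_vecMulVec_dotProduct_vec_vecMulVec, vec_vecMulVec_dotProduct_vec_vecMulVec,
    single_one_dotProduct, Pi.single_eq_same, one_mul]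
  linarith

theorem signalCoeff_le (h : PerturbationBounds d δ i S T K L) (hu : uᵀ * u = 1) (hv : vᵀ * v = 1)
    (x : ι → ℝ) :
    vec (signalCoeff d δ i S T x u v) ⬝ᵥ vec (signalCoeff d δ i S T x u v)
      ≤ 4 * K ^ 4 * L ^ 2 * ((uᵀ *ᵥ x) ⬝ᵥ (uᵀ *ᵥ x)) := by
  have hSu (y : ρ → ℝ) : ((Sᵀ * u) *ᵥ y) ⬝ᵥ ((Sᵀ * u) *ᵥ y) ≤ K * (y ⬝ᵥ y) := by
    simpa only [← mulVec_mulVec, mulVec_dotProduct_mulVec hu] using h.transpose_left_le (u *ᵥ y)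
  calc vec (signalCoeff d δ i S T x u v) ⬝ᵥ vec (signalCoeff d δ i S T x u v)
      ≤ K * (vec (signalCore d δ i T x u v) ⬝ᵥ vec (signalCore d δ i T x u v)) :=
        vec_mul_dotProduct_vec_mul_le hSu _
    _ ≤ K * (4 * K ^ 3 * L ^ 2 * ((uᵀ *ᵥ x) ⬝ᵥ (uᵀ *ᵥ x))) :=
        mul_le_mul_of_nonneg_left (h.signalCore_le hv x) h.nonneg
    _ = 4 * K ^ 4 * L ^ 2 * ((uᵀ *ᵥ x) ⬝ᵥ (uᵀ *ᵥ x)) := by ring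

theorem noiseCoeff_le (h : PerturbationBounds d δ i S T K L) (hu : uᵀ * u = 1) (hv : vᵀ * v = 1)
    (x : ι → ℝ) :
    vec (noiseCoeff d i S T x u v) ⬝ᵥ vec (noiseCoeff d i S T x u v) ≤ K ^ 4 * (x ⬝ᵥ x) := by
  have hproj : (x - u *ᵥ (uᵀ *ᵥ x)) ⬝ᵥ (x - u *ᵥ (uᵀ *ᵥ x)) ≤ x ⬝ᵥ x := by
    rw [sub_mulVec_transpose_mulVec_dotProduct_self hu]
    exact sub_le_self _ (dotProduct_self_nonneg _)
  have hS := (h.transpose_left_le _).trans (mul_le_mul_of_nonneg_left hproj h.nonneg)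
  have hmul := mul_le_mul hS (h.right_col_le hv) (dotProduct_self_nonneg _)
    ((dotProduct_self_nonneg _).trans hS)
  rw [noiseCoeff, vec_smul, smul_dotProduct_smul_self, vec_vecMulVec_dotProduct_vec_vecMulVec]
  refine (mul_le_mul (sq_le_sq.mpr (h.abs_inv_le.trans (le_abs_self K))) hmul
    (mul_nonneg (dotProduct_self_nonneg _) (dotProduct_self_nonneg _)) (sq_nonneg K)).trans_eq ?_
  ring

theorem transpose_left_mul_residual_le (h : PerturbationBounds d δ i S T K L) (hu : uᵀ * u = 1)
    (x : ι → ℝ) :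
    (uᵀ *ᵥ (S *ᵥ (Sᵀ *ᵥ (x - u *ᵥ (uᵀ *ᵥ x))))) ⬝ᵥ (uᵀ *ᵥ (S *ᵥ (Sᵀ *ᵥ (x - u *ᵥ (uᵀ *ᵥ x)))))
      ≤ 2 * ((uᵀ *ᵥ (S *ᵥ (Sᵀ *ᵥ x))) ⬝ᵥ (uᵀ *ᵥ (S *ᵥ (Sᵀ *ᵥ x)))
        + K ^ 2 * ((uᵀ *ᵥ x) ⬝ᵥ (uᵀ *ᵥ x))) := by
  have hproj : (uᵀ *ᵥ (S *ᵥ (Sᵀ *ᵥ -(u *ᵥ (uᵀ *ᵥ x))))) ⬝ᵥ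
      (uᵀ *ᵥ (S *ᵥ (Sᵀ *ᵥ -(u *ᵥ (uᵀ *ᵥ x))))) ≤ K ^ 2 * ((uᵀ *ᵥ x) ⬝ᵥ (uᵀ *ᵥ x)) := by
    refine (transpose_mulVec_dotProduct_self_le hu _).trans ((h.left_mul_transpose_le _).trans ?_)
    rw [neg_dotProduct_neg, mulVec_dotProduct_mulVec hu]
  rw [sub_eq_add_neg, mulVec_add, mulVec_add, mulVec_add]
  refine (add_dotProduct_self_le _ _).trans ?_
  linarith

/-- The cross term is as small as the square of the signal coefficient because both of its factors
are of the order of `uᵀ`, applied to `x` and to `S * Sᵀ * x`. -/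
theorem abs_signalCoeff_dotProduct_noiseCoeff_le (h : PerturbationBounds d δ i S T K L)
    (hu : uᵀ * u = 1) (hv : vᵀ * v = 1) (x : ι → ℝ) :
    |vec (signalCoeff d δ i S T x u v) ⬝ᵥ vec (noiseCoeff d i S T x u v)|
      ≤ K ^ 4 * (2 * L ^ 2 + 1) * ((uᵀ *ᵥ x) ⬝ᵥ (uᵀ *ᵥ x))
        + K ^ 2 * ((uᵀ *ᵥ (S *ᵥ (Sᵀ *ᵥ x))) ⬝ᵥ (uᵀ *ᵥ (S *ᵥ (Sᵀ *ᵥ x)))) := by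
  set y := uᵀ *ᵥ (S *ᵥ (Sᵀ *ᵥ (x - u *ᵥ (uᵀ *ᵥ x))))
  have hy := h.transpose_left_mul_residual_le hu x
  have hmul := mul_le_mul hy (h.right_col_le hv) (dotProduct_self_nonneg _)
    ((dotProduct_self_nonneg _).trans hy)
  have hcs := two_mul_abs_dotProduct_le (vec (signalCore d δ i T x u v))
    (vec (vecMulVec y (T *ᵥ v.col i)))
  rw [vec_vecMulVec_dotProduct_vec_vecMulVec] at hcs
  have hcore := h.signalCore_le (u := u) hv x
  have hhalf : |vec (signalCore d δ i T x u v) ⬝ᵥ vec (vecMulVec y (T *ᵥ v.col i))|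
      ≤ K ^ 3 * (2 * L ^ 2 + 1) * ((uᵀ *ᵥ x) ⬝ᵥ (uᵀ *ᵥ x))
        + K * ((uᵀ *ᵥ (S *ᵥ (Sᵀ *ᵥ x))) ⬝ᵥ (uᵀ *ᵥ (S *ᵥ (Sᵀ *ᵥ x)))) := by linarith
  rw [signalCoeff_dotProduct_noiseCoeff, abs_mul]
  refine (mul_le_mul h.abs_inv_le hhalf (abs_nonneg _) h.nonneg).trans_eq ?_
  ring

end PerturbationBounds

end Perturbation

section SecondMoments

variable {Ω : Type*} [MeasurableSpace Ω] {P : Measure Ω}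

/-- In dimension `N`, the random variable `f + g` has second moment of order `1 / N`, dominated by
its noise part `g`: the signal part `f` contributes only to order `1 / N ^ 2`. -/
def HasSecondMomentBounds (P : Measure Ω) (f g : Ω → ℝ) (C N : ℝ) : Prop :=
  MemLp (fun ω => f ω + g ω) 2 P ∧ MemLp g 2 P ∧
    ∫ ω, (f ω + g ω) ^ 2 ∂P ≤ C / N ∧ ∫ ω, g ω ^ 2 ∂P ≤ C / N ∧ ∫ ω, f ω ^ 2 ∂P ≤ C / N ^ 2 ∧
    |∫ ω, (f ω + g ω) ^ 2 ∂P - ∫ ω, g ω ^ 2 ∂P| ≤ C / N ^ 2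

theorem HasSecondMomentBounds.of_integral_le {f g : Ω → ℝ} {a b c N : ℝ} (hf : MemLp f 2 P)
    (hg : MemLp g 2 P) (hN : 1 ≤ N) (hgg : ∫ ω, g ω ^ 2 ∂P ≤ a / N)
    (hff : ∫ ω, f ω ^ 2 ∂P ≤ b / N ^ 2) (hfg : |∫ ω, f ω * g ω ∂P| ≤ c / N ^ 2) :
    HasSecondMomentBounds P f g (a + b + 2 * c) N := by
  have hN0 : 0 < N := zero_lt_one.trans_le hN
  have hexp : ∫ ω, (f ω + g ω) ^ 2 ∂P
      = ∫ ω, f ω ^ 2 ∂P + 2 * ∫ ω, f ω * g ω ∂P + ∫ ω, g ω ^ 2 ∂P := by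
    have hfgi : Integrable (fun ω => 2 * (f ω * g ω)) P := (hf.integrable_mul hg).const_mul 2
    have hsum : Integrable (fun ω => f ω ^ 2 + 2 * (f ω * g ω)) P := hf.integrable_sq.add hfgi
    simp only [add_sq, mul_assoc]
    rw [integral_add hsum hg.integrable_sq, integral_add hf.integrable_sq hfgi,
      integral_const_mul]
  have ha : 0 ≤ a := le_trans (by positivity) ((le_div_iff₀ hN0).mp hgg)
  have hb : 0 ≤ b := le_trans (by positivity) ((le_div_iff₀ (pow_pos hN0 2)).mp hff)
  have hc : 0 ≤ c := le_trans (by positivity) ((le_div_iff₀ (pow_pos hN0 2)).mp hfg)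
  have hfg' := abs_le.mp hfg
  have hdiff : |∫ ω, (f ω + g ω) ^ 2 ∂P - ∫ ω, g ω ^ 2 ∂P| ≤ (b + 2 * c) / N ^ 2 := by
    rw [hexp, add_div, mul_div_assoc, abs_le]
    have hff0 : 0 ≤ ∫ ω, f ω ^ 2 ∂P := by positivity
    constructor <;> linarith
  have hsum : ∫ ω, (f ω + g ω) ^ 2 ∂P ≤ (a + b + 2 * c) / N := by
    have hNN : (b + 2 * c) / N ^ 2 ≤ (b + 2 * c) / N := by
      gcongr
      exact le_self_pow₀ hN two_ne_zero
    rw [add_assoc, add_div]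
    linarith [le_of_abs_le hdiff]
  refine ⟨hf.add hg, hg, hsum, hgg.trans ?_, hff.trans ?_, hdiff.trans ?_⟩ <;> gcongr <;> linarith

variable {ι κ ρ α β : Type*}

/-- The inverse of `vec`. Measurability is expressed through `vec`, as matrices carry no
`MeasurableSpace` instance. -/
def unvec (y : ρ × ι → ℝ) : Matrix ι ρ ℝ := of fun a j => y (j, a)

theorem continuous_unvec : Continuous (unvec : (ρ × ι → ℝ) → Matrix ι ρ ℝ) :=
  continuous_matrix fun _ _ => continuous_apply _

variable [Fintype ι] [Fintype κ] [Fintype ρ]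

theorem memLp_two_of_dotProduct_self_le [IsFiniteMeasure P] {c : Ω → ι → ℝ}
    (hc : AEMeasurable c P) {b : ℝ} (hb : ∀ ω, c ω ⬝ᵥ c ω ≤ b) (s : ι) :
    MemLp (fun ω => c ω s) 2 P := by
  refine MemLp.of_bound ((measurable_pi_apply s).comp_aemeasurable hc).aestronglyMeasurable
    (Real.sqrt b) (.of_forall fun ω => Real.abs_le_sqrt ((le_of_eq ?_).trans
      ((Finset.single_le_sum (fun t _ => mul_self_nonneg (c ω t)) (Finset.mem_univ s)).trans
        (hb ω))))
  exact sq _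

theorem measurable_vec_noiseCoeff (d : ρ → ℝ) (i : ρ) (S : Matrix ι α ℝ) (T : Matrix β κ ℝ)
    (x : ι → ℝ) : Measurable fun w : (ρ × ι → ℝ) × (ρ × κ → ℝ) =>
      vec (noiseCoeff d i S T x (unvec w.1) (unvec w.2)) := by
  refine measurable_pi_lambda _ fun s => Continuous.measurable ?_
  have := continuous_unvec (ι := ι) (ρ := ρ)
  have := continuous_unvec (ι := κ) (ρ := ρ)
  unfold noiseCoeff vec Matrix.col
  fun_prop

variable [DecidableEq ρ]

theorem measurable_vec_signalCoeff (d δ : ρ → ℝ) (i : ρ) (S : Matrix ι α ℝ) (T : Matrix β κ ℝ)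
    (x : ι → ℝ) : Measurable fun w : (ρ × ι → ℝ) × (ρ × κ → ℝ) =>
      vec (signalCoeff d δ i S T x (unvec w.1) (unvec w.2)) := by
  refine measurable_pi_lambda _ fun s => Continuous.measurable ?_
  have := continuous_unvec (ι := ι) (ρ := ρ)
  have := continuous_unvec (ι := κ) (ρ := ρ)
  unfold signalCoeff signalCore vec Matrix.col
  fun_prop

/-- A random matrix with orthonormal columns. -/
structure IsOrthonormalFrame (u : Ω → Matrix ι ρ ℝ) (P : Measure Ω) : Prop where
  aemeasurable : AEMeasurable (fun ω => vec (u ω)) P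
  transpose_mul_self : ∀ ω, (u ω)ᵀ * u ω = 1

/-- A random orthonormal frame whose span is delocalized: its mean squared component along any fixed
unit vector is at most `ε`. -/
structure IsDelocalizedFrame (u : Ω → Matrix ι ρ ℝ) (ε : ℝ) (P : Measure Ω) : Prop
    extends IsOrthonormalFrame u P where
  integral_le : ∀ x, ∫ ω, ((u ω)ᵀ *ᵥ x) ⬝ᵥ ((u ω)ᵀ *ᵥ x) ∂P ≤ ε * (x ⬝ᵥ x)

theorem IsOrthonormalFrame.integrable [IsFiniteMeasure P] {u : Ω → Matrix ι ρ ℝ}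
    (hu : IsOrthonormalFrame u P) (x : ι → ℝ) :
    Integrable (fun ω => ((u ω)ᵀ *ᵥ x) ⬝ᵥ ((u ω)ᵀ *ᵥ x)) P := by
  have hcont : Continuous fun y : ρ × ι → ℝ => ((unvec y)ᵀ *ᵥ x) ⬝ᵥ ((unvec y)ᵀ *ᵥ x) := by
    have := continuous_unvec (ι := ι) (ρ := ρ)
    fun_prop
  refine .of_bound (hcont.measurable.comp_aemeasurable hu.aemeasurable).aestronglyMeasurable
    (x ⬝ᵥ x) (.of_forall fun ω => ?_)
  rw [Real.norm_of_nonneg (dotProduct_self_nonneg _)]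
  exact transpose_mulVec_dotProduct_self_le (hu.transpose_mul_self ω) x

namespace PerturbationBounds

variable [Fintype α] [Fintype β] {d δ : ρ → ℝ} {i : ρ} {S : Matrix ι α ℝ} {T : Matrix β κ ℝ}
  {K L ε : ℝ} {u : Ω → Matrix ι ρ ℝ} {v : Ω → Matrix κ ρ ℝ} {X : Ω → Matrix α β ℝ}

theorem memLp_signalCoeff [IsFiniteMeasure P] (h : PerturbationBounds d δ i S T K L)
    (hu : IsOrthonormalFrame u P) (hv : IsOrthonormalFrame v P) (x : ι → ℝ) (s : β × α) :
    MemLp (fun ω => vec (signalCoeff d δ i S T x (u ω) (v ω)) s) 2 P := by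
  have hK : 0 ≤ 4 * K ^ 4 * L ^ 2 := by positivity
  exact memLp_two_of_dotProduct_self_le ((measurable_vec_signalCoeff d δ i S T x).comp_aemeasurable
    (hu.aemeasurable.prodMk hv.aemeasurable)) (fun ω =>
      (h.signalCoeff_le (hu.transpose_mul_self ω) (hv.transpose_mul_self ω) x).trans
        (mul_le_mul_of_nonneg_left
          (transpose_mulVec_dotProduct_self_le (hu.transpose_mul_self ω) x) hK)) s

theorem memLp_noiseCoeff [IsFiniteMeasure P] (h : PerturbationBounds d δ i S T K L)
    (hu : IsOrthonormalFrame u P) (hv : IsOrthonormalFrame v P) (x : ι → ℝ) (s : β × α) :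
    MemLp (fun ω => vec (noiseCoeff d i S T x (u ω) (v ω)) s) 2 P :=
  memLp_two_of_dotProduct_self_le ((measurable_vec_noiseCoeff d i S T x).comp_aemeasurable
    (hu.aemeasurable.prodMk hv.aemeasurable))
    (fun ω => h.noiseCoeff_le (hu.transpose_mul_self ω) (hv.transpose_mul_self ω) x) s

theorem integral_signalCoeff_le [IsFiniteMeasure P] (h : PerturbationBounds d δ i S T K L)
    (hu : IsDelocalizedFrame u ε P) (hv : IsOrthonormalFrame v P) (x : ι → ℝ) :
    ∫ ω, vec (signalCoeff d δ i S T x (u ω) (v ω)) ⬝ᵥ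
        vec (signalCoeff d δ i S T x (u ω) (v ω)) ∂P
      ≤ 4 * K ^ 4 * L ^ 2 * ε * (x ⬝ᵥ x) := by
  have hbound := integral_mono_of_nonneg (μ := P)
    (.of_forall fun ω => dotProduct_self_nonneg _) ((hu.integrable x).const_mul _)
    (.of_forall fun ω =>
      h.signalCoeff_le (hu.transpose_mul_self ω) (hv.transpose_mul_self ω) x)
  refine hbound.trans ?_
  rw [integral_const_mul, mul_assoc _ ε]
  exact mul_le_mul_of_nonneg_left (hu.integral_le x) (by positivity)

theorem integral_noiseCoeff_le [IsProbabilityMeasure P] (h : PerturbationBounds d δ i S T K L)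
    (hu : IsOrthonormalFrame u P) (hv : IsOrthonormalFrame v P) (x : ι → ℝ) :
    ∫ ω, vec (noiseCoeff d i S T x (u ω) (v ω)) ⬝ᵥ vec (noiseCoeff d i S T x (u ω) (v ω)) ∂P
      ≤ K ^ 4 * (x ⬝ᵥ x) := by
  have hbound := integral_mono_of_nonneg (μ := P) (.of_forall fun ω => dotProduct_self_nonneg _)
    (integrable_const _) (.of_forall fun ω =>
      h.noiseCoeff_le (hu.transpose_mul_self ω) (hv.transpose_mul_self ω) x)
  simpa only [integral_const, probReal_univ, one_smul] using hbound

theorem abs_integral_signalCoeff_dotProduct_noiseCoeff_le [IsFiniteMeasure P]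
    (h : PerturbationBounds d δ i S T K L) (hε : 0 ≤ ε) (hu : IsDelocalizedFrame u ε P)
    (hv : IsOrthonormalFrame v P) (x : ι → ℝ) :
    |∫ ω, vec (signalCoeff d δ i S T x (u ω) (v ω)) ⬝ᵥ
        vec (noiseCoeff d i S T x (u ω) (v ω)) ∂P|
      ≤ 2 * K ^ 4 * (L ^ 2 + 1) * ε * (x ⬝ᵥ x) := by
  set z := S *ᵥ (Sᵀ *ᵥ x)
  have hz : z ⬝ᵥ z ≤ K ^ 2 * (x ⬝ᵥ x) := h.left_mul_transpose_le x
  have hint := (hu.integrable x).const_mul (K ^ 4 * (2 * L ^ 2 + 1))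
  have hint' := (hu.integrable z).const_mul (K ^ 2)
  calc |∫ ω, vec (signalCoeff d δ i S T x (u ω) (v ω)) ⬝ᵥ
        vec (noiseCoeff d i S T x (u ω) (v ω)) ∂P|
      ≤ ∫ ω, (K ^ 4 * (2 * L ^ 2 + 1) * (((u ω)ᵀ *ᵥ x) ⬝ᵥ ((u ω)ᵀ *ᵥ x))
          + K ^ 2 * (((u ω)ᵀ *ᵥ z) ⬝ᵥ ((u ω)ᵀ *ᵥ z))) ∂P :=
        abs_integral_le_integral_abs.trans (integral_mono_of_nonneg
          (.of_forall fun ω => abs_nonneg _) (hint.add hint') (.of_forall fun ω =>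
            h.abs_signalCoeff_dotProduct_noiseCoeff_le (hu.transpose_mul_self ω)
              (hv.transpose_mul_self ω) x))
    _ = K ^ 4 * (2 * L ^ 2 + 1) * ∫ ω, ((u ω)ᵀ *ᵥ x) ⬝ᵥ ((u ω)ᵀ *ᵥ x) ∂P
          + K ^ 2 * ∫ ω, ((u ω)ᵀ *ᵥ z) ⬝ᵥ ((u ω)ᵀ *ᵥ z) ∂P := by
        rw [integral_add hint hint', integral_const_mul, integral_const_mul]
    _ ≤ K ^ 4 * (2 * L ^ 2 + 1) * (ε * (x ⬝ᵥ x)) + K ^ 2 * (ε * (K ^ 2 * (x ⬝ᵥ x))) := by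
        gcongr
        · exact hu.integral_le x
        · exact (hu.integral_le z).trans (mul_le_mul_of_nonneg_left hz hε)
    _ = 2 * K ^ 4 * (L ^ 2 + 1) * ε * (x ⬝ᵥ x) := by ring

theorem hasSecondMomentBounds [DecidableEq ι] [IsProbabilityMeasure P]
    (h : PerturbationBounds d δ i S T K L) {B N : ℝ} (hB : 0 ≤ B) (hN : 1 ≤ N)
    (hu : IsDelocalizedFrame u (B / N) P) (hv : IsOrthonormalFrame v P)
    (hX : IsWhiteNoise (fun ω => vec (X ω)) N⁻¹ P)
    (hind : IndepFun (fun ω => (vec (u ω), vec (v ω))) (fun ω => vec (X ω)) P)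
    {x : ι → ℝ} (hx : x ⬝ᵥ x = 1) :
    HasSecondMomentBounds P (fun ω => x ⬝ᵥ signalPart d δ i (u ω) (v ω) (S * X ω * T))
      (fun ω => x ⬝ᵥ noisePart d i (u ω) (v ω) (S * X ω * T))
      (K ^ 4 * (1 + 4 * B * (2 * L ^ 2 + 1))) N := by
  have hN0 : 0 < N := zero_lt_one.trans_le hN
  have hf := h.memLp_signalCoeff hu.toIsOrthonormalFrame hv x
  have hg := h.memLp_noiseCoeff hu.toIsOrthonormalFrame hv x
  have hfX := hind.comp (measurable_vec_signalCoeff d δ i S T x) measurable_id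
  have hgX := hind.comp (measurable_vec_noiseCoeff d i S T x) measurable_id
  have hfgX := hind.comp ((measurable_vec_signalCoeff d δ i S T x).prodMk
    (measurable_vec_noiseCoeff d i S T x)) measurable_id
  have hconst : K ^ 4 * (1 + 4 * B * (2 * L ^ 2 + 1))
      = K ^ 4 + 4 * K ^ 4 * L ^ 2 * B + 2 * (2 * K ^ 4 * (L ^ 2 + 1) * B) := by ring
  simp only [dotProduct_signalPart, dotProduct_noisePart, hconst]
  refine .of_integral_le (hX.memLp_dotProduct hf hfX) (hX.memLp_dotProduct hg hgX) hN ?_ ?_ ?_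
  · rw [hX.integral_dotProduct_sq hg hgX, inv_mul_eq_div]
    gcongr
    simpa only [hx, mul_one] using h.integral_noiseCoeff_le hu.toIsOrthonormalFrame hv x
  · rw [hX.integral_dotProduct_sq hf hfX, inv_mul_eq_div, sq N, ← div_div]
    gcongr
    simpa only [hx, mul_one, ← mul_div_assoc] using h.integral_signalCoeff_le hu hv x
  · rw [hX.integral_dotProduct_mul_dotProduct hf hg hfgX, abs_mul, abs_of_pos (inv_pos.mpr hN0),
      inv_mul_eq_div, sq N, ← div_div]
    gcongr
    simpa only [hx, mul_one, ← mul_div_assoc] using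
      h.abs_integral_signalCoeff_dotProduct_noiseCoeff_le (by positivity) hu hv x

end PerturbationBounds

end SecondMoments

section Deterministic

variable {ι κ ρ α β : Type*} [Fintype ι] [DecidableEq ρ]

/-- The entries `1 / (d i ^ 2 - d j ^ 2)` of the matrix `D_i`, with value `0` at `j = i`. -/
def invGap (d : ρ → ℝ) (i j : ρ) : ℝ := if j = i then 0 else 1 / (d i ^ 2 - d j ^ 2)

theorem abs_invGap_le {d : ρ → ℝ} {i : ρ} {τ : ℝ} (hτ : 0 < τ) (hd : ∀ j, 0 ≤ d j)
    (hi : τ ≤ d i) (hgap : ∀ j, i ≠ j → τ ≤ |d i - d j|) (j : ρ) :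
    |invGap d i j| ≤ (τ ^ 2)⁻¹ := by
  unfold invGap
  split_ifs with hji
  · rw [abs_zero]
    positivity
  · have hsum : τ ≤ d i + d j := hi.trans (le_add_of_nonneg_right (hd j))
    rw [sq_sub_sq, abs_div, abs_one, one_div, abs_mul, abs_of_pos (hτ.trans_le hsum), sq]
    exact inv_anti₀ (mul_pos hτ hτ)
      (mul_le_mul hsum (hgap j (Ne.symm hji)) hτ.le (hτ.le.trans hsum))

theorem PerturbationBounds.of_gap [Fintype κ] [Fintype α] [Fintype β] {d : ρ → ℝ} {i : ρ}
    {S : Matrix ι α ℝ} {T : Matrix β κ ℝ} {τ : ℝ} (hτ : 0 < τ)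
    (hS : ∀ y, (S *ᵥ y) ⬝ᵥ (S *ᵥ y) ≤ τ⁻¹ * (y ⬝ᵥ y))
    (hT : ∀ y, (T *ᵥ y) ⬝ᵥ (T *ᵥ y) ≤ τ⁻¹ * (y ⬝ᵥ y)) (hd : ∀ j, 0 ≤ d j)
    (hd_le : ∀ j, d j ≤ τ⁻¹) (hi : τ ≤ d i) (hgap : ∀ j, i ≠ j → τ ≤ |d i - d j|) :
    PerturbationBounds d (invGap d i) i S T τ⁻¹ (τ ^ 2)⁻¹ where
  nonneg := inv_nonneg.mpr hτ.le
  left := hS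
  right := hT
  abs_le j := (abs_of_nonneg (hd j)).trans_le (hd_le j)
  abs_inv_le := by
    rw [abs_of_nonneg (inv_nonneg.mpr (hd i))]
    exact inv_anti₀ hτ hi
  abs_invGap_le := _root_.abs_invGap_le hτ hd hi hgap

variable [DecidableEq ι]

theorem mul_diagonal_mul_transpose_mulVec_dotProduct_self_le {Q : Matrix ι ι ℝ}
    (hQ : Q ∈ orthogonalGroup ι ℝ) {σ : ι → ℝ} {L : ℝ} (hσ : ∀ j, |σ j| ≤ L) (x : ι → ℝ) :
    ((Q * diagonal σ * Qᵀ) *ᵥ x) ⬝ᵥ ((Q * diagonal σ * Qᵀ) *ᵥ x) ≤ L ^ 2 * (x ⬝ᵥ x) := by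
  have hQ' : (Qᵀ)ᵀ * Qᵀ = 1 := (mem_orthogonalGroup_iff ι ℝ).mp hQ
  rw [← mulVec_mulVec, ← mulVec_mulVec,
    mulVec_dotProduct_mulVec ((mem_orthogonalGroup_iff' ι ℝ).mp hQ)]
  simpa only [mulVec_dotProduct_mulVec hQ'] using diagonal_mulVec_dotProduct_self_le hσ (Qᵀ *ᵥ x)

theorem transpose_mul_diagonal_mul_transpose (Q : Matrix ι ι ℝ) (σ : ι → ℝ) :
    (Q * diagonal σ * Qᵀ)ᵀ = Q * diagonal σ * Qᵀ := by
  simp only [transpose_mul, transpose_transpose, diagonal_transpose, Matrix.mul_assoc]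

end Deterministic

section LeadingColumns

variable {m r : ℕ} (hr : r ≤ m) {Q : Matrix (Fin m) (Fin m) ℝ}

theorem transpose_submatrix_castLE_mul_submatrix_castLE (hQ : Q ∈ orthogonalGroup (Fin m) ℝ) :
    (Q.submatrix id (Fin.castLE hr))ᵀ * Q.submatrix id (Fin.castLE hr) = 1 := by
  rw [transpose_submatrix, ← submatrix_mul _ _ _ id _ Function.bijective_id,
    (mem_orthogonalGroup_iff' _ _).mp hQ, submatrix_one _ (Fin.castLE_injective hr)]

theorem submatrix_val_mul_transpose_submatrix_val (hQ : Q ∈ orthogonalGroup (Fin m) ℝ) :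
    Q.submatrix id (Subtype.val : {g : Fin m // r ≤ (g : ℕ)} → Fin m) *
        (Q.submatrix id (Subtype.val : {g : Fin m // r ≤ (g : ℕ)} → Fin m))ᵀ
      = 1 - Q.submatrix id (Fin.castLE hr) * (Q.submatrix id (Fin.castLE hr))ᵀ := by
  have hone : Q * Qᵀ = 1 := (mem_orthogonalGroup_iff _ _).mp hQ
  rw [eq_sub_iff_add_eq, ← hone]
  ext a b
  simp only [Matrix.add_apply, mul_apply, transpose_apply, submatrix_apply, id]
  rw [← Fintype.sum_subtype_add_sum_subtype (fun g : Fin m => r ≤ (g : ℕ))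
    (fun g => Q a g * Q b g)]
  congr 1
  refine Fintype.sum_bijective (fun j : Fin r => (⟨Fin.castLE hr j, by simp⟩ :
    {g : Fin m // ¬ r ≤ (g : ℕ)})) ⟨fun j l h => ?_, fun g => ?_⟩ _ _ fun j => rfl
  · exact Fin.castLE_injective hr (Subtype.ext_iff.mp h)
  · exact ⟨⟨g.1, not_le.mp g.2⟩, rfl⟩

theorem mul_submatrix_castLE_of_blockTriangular {R : Matrix (Fin m) (Fin m) ℝ}
    (hR : R.BlockTriangular id) :
    (Q * R).submatrix id (Fin.castLE hr)
      = Q.submatrix id (Fin.castLE hr) * R.submatrix (Fin.castLE hr) (Fin.castLE hr) := by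
  ext a k
  simp only [submatrix_apply, mul_apply, id]
  refine (Finset.sum_of_injOn (Fin.castLE hr) (Fin.castLE_injective hr).injOn
    (fun _ _ => Finset.mem_univ _) (fun b _ hb => ?_) (fun b _ => rfl)).symm
  have hkb : Fin.castLE hr k < b :=
    lt_of_not_ge fun hbk => hb ⟨⟨b, (Fin.le_def.mp hbk).trans_lt k.2⟩, by simp, rfl⟩
  exact mul_eq_zero_of_right _ (hR hkb)

end LeadingColumns

variable {Ω : Type*} [MeasurableSpace Ω] {P : Measure Ω} {ν : Measure ℝ}

namespace HasIIDEntries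

variable {ι κ ι' κ' : Type*} {g : Ω → Matrix ι κ ℝ}

theorem submatrix (hg : HasIIDEntries g ν P) {e : ι' → ι} {f : κ' → κ}
    (he : Function.Injective e) (hf : Function.Injective f) :
    HasIIDEntries (fun ω => (g ω).submatrix e f) ν P where
  hasLaw a k := hg.hasLaw (e a) (f k)
  iIndepFun := hg.iIndepFun.precomp (g := Prod.map e f) (he.prodMap hf)

theorem transpose (hg : HasIIDEntries g ν P) : HasIIDEntries (fun ω => (g ω)ᵀ) ν P where
  hasLaw k a := hg.hasLaw a k
  iIndepFun := hg.iIndepFun.precomp (g := Prod.swap) Prod.swap_injective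

theorem isWhiteNoise_vec (hg : HasIIDEntries g ν P) (hν : MemLp id 2 ν) (hmean : ∫ x, x ∂ν = 0) :
    IsWhiteNoise (fun ω => vec (g ω)) (∫ x, x ^ 2 ∂ν) P :=
  .of_pairwise_indepFun (fun s => hg.memLp_comp hν s.2 s.1)
    (fun s t hst => hg.iIndepFun.indepFun (i := s.swap) (j := t.swap)
      (Prod.swap_injective.ne hst))
    (fun s => (hg.integral_comp hν.1 s.2 s.1).trans hmean)
    (fun s => hg.integral_comp (f := fun x => x ^ 2) (by fun_prop) s.2 s.1)

theorem isWhiteNoise_vec_of_gaussianReal {v : NNReal} (hg : HasIIDEntries g (gaussianReal 0 v) P) :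
    IsWhiteNoise (fun ω => vec (g ω)) v P := by
  have hsq : ∫ x, x ^ 2 ∂gaussianReal 0 v = v := by
    rw [← variance_of_integral_eq_zero aemeasurable_id' integral_id_gaussianReal,
      variance_fun_id_gaussianReal]
  simpa only [hsq] using hg.isWhiteNoise_vec (memLp_id_gaussianReal' 2 (by simp))
    integral_id_gaussianReal

end HasIIDEntries

namespace IsQRFactor

variable {m r : ℕ} {Q : Matrix (Fin m) (Fin m) ℝ → Matrix (Fin m) (Fin m) ℝ}

theorem measurable_vec_submatrix (hQ : IsQRFactor Q) (hr : r ≤ m) :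
    Measurable fun G : Fin m → Fin m → ℝ => vec ((Q (of G)).submatrix id (Fin.castLE hr)) :=
  measurable_pi_lambda _ fun s =>
    (measurable_pi_apply (Fin.castLE hr s.1)).comp
      ((measurable_pi_apply s.2).comp hQ.measurable)

theorem mul_transpose_mul (hQ : IsQRFactor Q) (G : Matrix (Fin m) (Fin m) ℝ) :
    Q G * ((Q G)ᵀ * G) = G := by
  rw [← Matrix.mul_assoc]
  exact (congrArg (· * G) ((mem_orthogonalGroup_iff _ _).mp (hQ.orthogonal G))).trans (one_mul G)

theorem isDelocalizedFrame [NeZero m] [IsProbabilityMeasure P] [IsProbabilityMeasure ν]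
    (hQ : IsQRFactor Q) (hr : r ≤ m) {G : Ω → Matrix (Fin m) (Fin m) ℝ}
    (hG : HasIIDEntries G ν P) (hν : MemLp id 2 ν) (hmean : ∫ x, x ∂ν = 0)
    (hν0 : ν ≠ Measure.dirac 0) {ε : ℝ} (hε : qrDelocConst ν r / m ≤ ε) :
    IsDelocalizedFrame (fun ω => (Q (G ω)).submatrix id (Fin.castLE hr)) ε P where
  aemeasurable := (hQ.measurable_vec_submatrix hr).comp_aemeasurable
    (aemeasurable_pi_lambda _ fun a => aemeasurable_pi_lambda _ fun b =>
      (hG.hasLaw a b).aemeasurable)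
  transpose_mul_self ω :=
    transpose_submatrix_castLE_mul_submatrix_castLE hr (hQ.orthogonal (G ω))
  integral_le x := by
    have hGr := hG.submatrix Function.injective_id (Fin.castLE_injective hr)
    have h := hGr.integral_qr_transpose_mulVec_le hν hmean hν0
      (fun ω => transpose_submatrix_castLE_mul_submatrix_castLE hr (hQ.orthogonal (G ω)))
      (fun ω => by
        rw [← mul_submatrix_castLE_of_blockTriangular hr (hQ.upperTriangular (G ω)),
          hQ.mul_transpose_mul]) x
    rw [Fintype.card_fin, Fintype.card_fin] at h
    exact h.trans (mul_le_mul_of_nonneg_right hε (dotProduct_self_nonneg x))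

end IsQRFactor

namespace SpikedModel

variable {τ : ℝ} {r p n : ℕ} (M : SpikedModel τ ν r p n P)

theorem hasIIDEntries_X : HasIIDEntries M.X (gaussianReal 0 (1 / (n : NNReal))) P where
  hasLaw := M.X_law
  iIndepFun := M.indep.precomp Sum.inl_injective

theorem isWhiteNoise_X : IsWhiteNoise (fun ω => vec (M.X ω)) (n : ℝ)⁻¹ P := by
  simpa only [one_div, NNReal.coe_inv, NNReal.coe_natCast] using
    M.hasIIDEntries_X.isWhiteNoise_vec_of_gaussianReal

theorem isWhiteNoise_X_transpose : IsWhiteNoise (fun ω => vec (M.X ω)ᵀ) (n : ℝ)⁻¹ P := by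
  simpa only [one_div, NNReal.coe_inv, NNReal.coe_natCast] using
    M.hasIIDEntries_X.transpose.isWhiteNoise_vec_of_gaussianReal

theorem hasIIDEntries_Gu : HasIIDEntries M.Gu ν P where
  hasLaw := M.Gu_law
  iIndepFun := M.indep.precomp (g := fun s => Sum.inr (Sum.inl s))
    (Sum.inr_injective.comp Sum.inl_injective)

theorem hasIIDEntries_Gv : HasIIDEntries M.Gv ν P where
  hasLaw := M.Gv_law
  iIndepFun := M.indep.precomp (g := fun s => Sum.inr (Sum.inr s))
    (Sum.inr_injective.comp Sum.inr_injective)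

theorem indepFun_factors_X :
    IndepFun (fun ω => ((fun j k => M.Gu ω j k), (fun j k => M.Gv ω j k)))
      (fun ω => vec (M.X ω)) P := by
  classical
  have hmeas (s : (Fin p × Fin n) ⊕ (Fin p × Fin p) ⊕ (Fin n × Fin n)) : AEMeasurable
      (fun ω => Sum.elim (fun jk => M.X ω jk.1 jk.2)
        (Sum.elim (fun jk => M.Gu ω jk.1 jk.2) (fun jk => M.Gv ω jk.1 jk.2)) s) P := by
    rcases s with s | s | s
    · exact (M.X_law s.1 s.2).aemeasurable
    · exact (M.Gu_law s.1 s.2).aemeasurable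
    · exact (M.Gv_law s.1 s.2).aemeasurable
  have h := M.indep.indepFun_finset₀ (Finset.univ.image Sum.inr) (Finset.univ.image Sum.inl)
    (by simp [Finset.disjoint_left]) hmeas
  refine h.comp (φ := fun y => ((fun j k => y ⟨Sum.inr (Sum.inl (j, k)), by simp⟩ :
      Fin p → Fin p → ℝ), (fun j k => y ⟨Sum.inr (Sum.inr (j, k)), by simp⟩ :
      Fin n → Fin n → ℝ))) (ψ := fun y (s : Fin n × Fin p) => y ⟨Sum.inl s.swap, by simp⟩) ?_ ?_
  · fun_prop
  · fun_prop

theorem indepFun_frames_X :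
    IndepFun (fun ω => (vec (M.Ur ω), vec (M.Vr ω))) (fun ω => vec (M.X ω)) P :=
  M.indepFun_factors_X.comp
    ((M.qru_spec.measurable_vec_submatrix M.rank_le_rows).prodMap
      (M.qrv_spec.measurable_vec_submatrix M.rank_le_cols)) measurable_id

theorem indepFun_frames_X_transpose :
    IndepFun (fun ω => (vec (M.Vr ω), vec (M.Ur ω))) (fun ω => vec (M.X ω)ᵀ) P :=
  M.indepFun_frames_X.comp (ψ := fun (y : Fin n × Fin p → ℝ) (s : Fin p × Fin n) => y s.swap)
    measurable_swap (measurable_pi_lambda _ fun _ => measurable_pi_apply _)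

theorem sqrtA_mulVec_dotProduct_self_le (hτ : 0 < τ) (x : Fin p → ℝ) :
    (M.sqrtA *ᵥ x) ⬝ᵥ (M.sqrtA *ᵥ x) ≤ τ⁻¹ * (x ⬝ᵥ x) := by
  rw [← Real.sq_sqrt (inv_nonneg.mpr hτ.le)]
  exact mul_diagonal_mul_transpose_mulVec_dotProduct_self_le M.Qa_mem (fun j =>
    (abs_of_nonneg (Real.sqrt_nonneg _)).trans_le (Real.sqrt_le_sqrt (M.σa_le j))) x

theorem sqrtB_mulVec_dotProduct_self_le (hτ : 0 < τ) (x : Fin n → ℝ) :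
    (M.sqrtB *ᵥ x) ⬝ᵥ (M.sqrtB *ᵥ x) ≤ τ⁻¹ * (x ⬝ᵥ x) := by
  rw [← Real.sq_sqrt (inv_nonneg.mpr hτ.le)]
  exact mul_diagonal_mul_transpose_mulVec_dotProduct_self_le M.Qb_mem (fun j =>
    (abs_of_nonneg (Real.sqrt_nonneg _)).trans_le (Real.sqrt_le_sqrt (M.σb_le j))) x

theorem Z_transpose (ω : Ω) : (M.Z ω)ᵀ = M.sqrtB * (M.X ω)ᵀ * M.sqrtA := by
  rw [Z, transpose_mul, transpose_mul, sqrtA, sqrtB, transpose_mul_diagonal_mul_transpose,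
    transpose_mul_diagonal_mul_transpose, ← Matrix.mul_assoc]

theorem duR_eq_signalPart (i : Fin r) (ω : Ω) :
    M.duR i ω = signalPart M.d (invGap M.d i) i (M.Ur ω) (M.Vr ω)
      (M.sqrtA * M.X ω * M.sqrtB) :=
  rfl

theorem duC_eq_noisePart (i : Fin r) (ω : Ω) :
    M.duC i ω = noisePart M.d i (M.Ur ω) (M.Vr ω) (M.sqrtA * M.X ω * M.sqrtB) := by
  rw [duC, Uc, submatrix_val_mul_transpose_submatrix_val M.rank_le_rows (Q := M.U ω)
    (M.qru_spec.orthogonal (M.Gu ω))]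
  rfl

theorem dvR_eq_signalPart (i : Fin r) (ω : Ω) :
    M.dvR i ω = signalPart M.d (invGap M.d i) i (M.Vr ω) (M.Ur ω)
      (M.sqrtB * (M.X ω)ᵀ * M.sqrtA) := by
  rw [← Z_transpose]
  rfl

theorem dvC_eq_noisePart (i : Fin r) (ω : Ω) :
    M.dvC i ω = noisePart M.d i (M.Vr ω) (M.Ur ω) (M.sqrtB * (M.X ω)ᵀ * M.sqrtA) := by
  rw [← Z_transpose, dvC, Vc, submatrix_val_mul_transpose_submatrix_val M.rank_le_cols
    (Q := M.V ω) (M.qrv_spec.orthogonal (M.Gv ω))]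
  rfl

theorem one_le_inv_τ (M : SpikedModel τ ν r p n P) (hτ : 0 < τ) : 1 ≤ τ⁻¹ := by
  refine (one_le_inv₀ hτ).mpr (le_of_not_gt fun h => ?_)
  exact ((M.lt_ratio.trans M.ratio_lt).trans (inv_lt_one_of_one_lt₀ h)).not_gt h

section Delocalization

variable [NeZero n] [IsProbabilityMeasure P] [IsProbabilityMeasure ν]

theorem isDelocalizedFrame_Ur (hτ : 0 < τ) (hν : MemLp id 2 ν) (hmean : ∫ x, x ∂ν = 0)
    (hν0 : ν ≠ Measure.dirac 0) : IsDelocalizedFrame M.Ur (qrDelocConst ν r * τ⁻¹ / n) P := by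
  have hn : (0 : ℝ) < n := Nat.cast_pos.mpr (NeZero.pos n)
  have hpn : τ * n < p := (lt_div_iff₀ hn).mp M.lt_ratio
  have hp : (0 : ℝ) < p := (mul_pos hτ hn).trans hpn
  have : NeZero p := ⟨(Nat.cast_pos.mp hp).ne'⟩
  refine M.qru_spec.isDelocalizedFrame M.rank_le_rows M.hasIIDEntries_Gu hν hmean hν0 ?_
  rw [← div_eq_mul_inv, div_div]
  exact div_le_div_of_nonneg_left (qrDelocConst_nonneg ν r) (mul_pos hτ hn) hpn.le

theorem isDelocalizedFrame_Vr (hτ : 0 < τ) (hν : MemLp id 2 ν) (hmean : ∫ x, x ∂ν = 0)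
    (hν0 : ν ≠ Measure.dirac 0) : IsDelocalizedFrame M.Vr (qrDelocConst ν r * τ⁻¹ / n) P := by
  refine M.qrv_spec.isDelocalizedFrame M.rank_le_cols M.hasIIDEntries_Gv hν hmean hν0 ?_
  gcongr
  exact le_mul_of_one_le_right (qrDelocConst_nonneg ν r) (M.one_le_inv_τ hτ)

/-- The constant `C` in the second moment bounds: that of
`PerturbationBounds.hasSecondMomentBounds` with `K = τ⁻¹`, `L = (τ ^ 2)⁻¹` and delocalization
constant `qrDelocConst ν r * τ⁻¹`. -/
def momentConst (τ : ℝ) (ν : Measure ℝ) (r : ℕ) : ℝ :=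
  τ⁻¹ ^ 4 * (1 + 4 * (qrDelocConst ν r * τ⁻¹) * (2 * ((τ ^ 2)⁻¹) ^ 2 + 1))

theorem hasSecondMomentBounds_du (hτ : 0 < τ) (hν : MemLp id 2 ν) (hmean : ∫ x, x ∂ν = 0)
    (hν0 : ν ≠ Measure.dirac 0) {i : Fin r} (hi : τ ≤ M.d i) (a : Fin p) :
    HasSecondMomentBounds P (fun ω => M.duR i ω a) (fun ω => M.duC i ω a)
      (momentConst τ ν r) n := by
  have hbounds := PerturbationBounds.of_gap hτ (M.sqrtA_mulVec_dotProduct_self_le hτ)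
    (M.sqrtB_mulVec_dotProduct_self_le hτ) (fun j => (M.d_pos j).le) (fun j => (M.d_lt j).le) hi
    (fun j hij => (M.d_gap i j hij).le)
  have h := hbounds.hasSecondMomentBounds (mul_nonneg (qrDelocConst_nonneg ν r)
    (inv_nonneg.mpr hτ.le)) (Nat.one_le_cast.mpr (NeZero.pos n))
    (M.isDelocalizedFrame_Ur hτ hν hmean hν0)
    (M.isDelocalizedFrame_Vr hτ hν hmean hν0).toIsOrthonormalFrame M.isWhiteNoise_X
    M.indepFun_frames_X (x := Pi.single a 1) (by rw [single_one_dotProduct, Pi.single_eq_same])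
  simpa only [momentConst, single_one_dotProduct, ← duR_eq_signalPart, ← duC_eq_noisePart] using h

theorem hasSecondMomentBounds_dv (hτ : 0 < τ) (hν : MemLp id 2 ν) (hmean : ∫ x, x ∂ν = 0)
    (hν0 : ν ≠ Measure.dirac 0) {i : Fin r} (hi : τ ≤ M.d i) (b : Fin n) :
    HasSecondMomentBounds P (fun ω => M.dvR i ω b) (fun ω => M.dvC i ω b)
      (momentConst τ ν r) n := by
  have hbounds := PerturbationBounds.of_gap hτ (M.sqrtB_mulVec_dotProduct_self_le hτ)
    (M.sqrtA_mulVec_dotProduct_self_le hτ) (fun j => (M.d_pos j).le) (fun j => (M.d_lt j).le) hi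
    (fun j hij => (M.d_gap i j hij).le)
  have h := hbounds.hasSecondMomentBounds (mul_nonneg (qrDelocConst_nonneg ν r)
    (inv_nonneg.mpr hτ.le)) (Nat.one_le_cast.mpr (NeZero.pos n))
    (M.isDelocalizedFrame_Vr hτ hν hmean hν0)
    (M.isDelocalizedFrame_Ur hτ hν hmean hν0).toIsOrthonormalFrame M.isWhiteNoise_X_transpose
    M.indepFun_frames_X_transpose (x := Pi.single b 1)
    (by rw [single_one_dotProduct, Pi.single_eq_same])
  simpa only [momentConst, single_one_dotProduct, ← dvR_eq_signalPart, ← dvC_eq_noisePart] using h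

end Delocalization

end SpikedModel

end

theorem mainTheorem3_general (τ : ℝ) (hτ : 0 < τ) (r : ℕ) (ν : Measure ℝ)
    [IsProbabilityMeasure ν] (hν_sq : MemLp id 2 ν) (hν_mean : ∫ x, x ∂ν = 0)
    (hν : ν ≠ Measure.dirac 0) :
    ∃ C : ℝ, 0 < C ∧ ∀ (n p : ℕ) (Ω : Type*) [MeasurableSpace Ω] (P : Measure Ω)
      [IsProbabilityMeasure P] (M : SpikedModel τ ν r p n P) (i : Fin r), τ ≤ M.d i →
      (∀ a, HasSecondMomentBounds P (fun ω => M.duR i ω a) (fun ω => M.duC i ω a) C n) ∧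
      (∀ b, HasSecondMomentBounds P (fun ω => M.dvR i ω b) (fun ω => M.dvC i ω b) C n) := by
  have hB := qrDelocConst_nonneg ν r
  refine ⟨SpikedModel.momentConst τ ν r, by unfold SpikedModel.momentConst; positivity,
    fun n p Ω _ P _ M i hi => ?_⟩
  have : NeZero n := ⟨(i.pos.trans_le M.rank_le_cols).ne'⟩
  exact ⟨M.hasSecondMomentBounds_du hτ hν_sq hν_mean hν hi,
    M.hasSecondMomentBounds_dv hτ hν_sq hν_mean hν hi⟩

theorem mainTheorem3 (τ : ℝ) (hτ0 : 0 < τ) (hτ1 : τ < 1) (r : ℕ)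
    (ν : Measure ℝ) [IsProbabilityMeasure ν]
    (hν_sq : Integrable (fun x : ℝ => x ^ 2) ν) (hν_mean : ∫ x, x ∂ν = 0)
    (hν_var : ∫ x, x ^ 2 ∂ν = 1) (hν_lsi : SatisfiesLogSobolev ν) :
    ∃ C : ℝ, 0 < C ∧ ∃ N : ℕ, ∀ n : ℕ, N ≤ n → ∀ (p : ℕ) (Ω : Type*) [MeasurableSpace Ω]
      (P : Measure Ω) [IsProbabilityMeasure P] (M : SpikedModel τ ν r p n P) (i : Fin r),
      τ ≤ M.d i →
      (∀ a : Fin p,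
        MemLp (fun ω => M.du i ω a) 2 P ∧ MemLp (fun ω => M.duC i ω a) 2 P ∧
        ∫ ω, (M.du i ω a) ^ 2 ∂P ≤ C / n ∧
        ∫ ω, (M.duC i ω a) ^ 2 ∂P ≤ C / n ∧
        ∫ ω, (M.duR i ω a) ^ 2 ∂P ≤ C / (n : ℝ) ^ 2 ∧
        |∫ ω, (M.du i ω a) ^ 2 ∂P - ∫ ω, (M.duC i ω a) ^ 2 ∂P| ≤ C / (n : ℝ) ^ 2) ∧
      (∀ b : Fin n,
        MemLp (fun ω => M.dv i ω b) 2 P ∧ MemLp (fun ω => M.dvC i ω b) 2 P ∧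
        ∫ ω, (M.dv i ω b) ^ 2 ∂P ≤ C / n ∧
        ∫ ω, (M.dvC i ω b) ^ 2 ∂P ≤ C / n ∧
        ∫ ω, (M.dvR i ω b) ^ 2 ∂P ≤ C / (n : ℝ) ^ 2 ∧
        |∫ ω, (M.dv i ω b) ^ 2 ∂P - ∫ ω, (M.dvC i ω b) ^ 2 ∂P| ≤ C / (n : ℝ) ^ 2) := by
  have hν : ν ≠ Measure.dirac 0 := by
    rintro rfl
    simp at hν_var
  obtain ⟨C, hC, hbounds⟩ := mainTheorem3_general τ hτ0 r ν
    ((memLp_two_iff_integrable_sq aestronglyMeasurable_id).mpr hν_sq) hν_mean hν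
  exact ⟨C, hC, 0, fun n _ => hbounds n⟩
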